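/- Let $S$ be a nonempty set of $n$ binary strings of length $w\ge 1$ (identified with integers in $[0,2^w)$), stored as a sorted array $S[0],\dots,S[n-1]$. For a binary string $x$ of length $w$ let $x^-=\max\{y\in S: y<x\}$, $x^+=\min\{y\in S: y\ge x\}$ and $D(x,S)=\max\{x^+-x,\;x-x^-\}$ (if only one of $x^\pm$ exists, only its term is used). Logarithms are binary, with $\log y=1$ for $y<2$. *Trie notation.* In the compacted trie of $S$ the extent $e_\alpha$ of a node $\alpha$ is the longest common prefix of the elements of $S$ below $\alpha$. Its name $n_\alpha$ is the empty string if $\alpha$ is the root, and otherwise the prefix of $e_\alpha$ that is one bit longer than the extent of the parent. Its skip interval is $[|n_\alpha|..|e_\alpha|]$ ($[1..|e_\alpha|]$ for the root). The handle $h_\alpha$ is the prefix of $e_\alpha$ whose length is the 2-fattest number of the skip interval, i.e. the one divisible by the largest power of two (the empty string if the interval is empty). The exit node $\mathrm{exit}(x)$ of $x$ is the only node $\alpha$ such that $n_\alpha$ is a prefix of $x$ and either $e_\alpha=x$ or $e_\alpha$ is not a prefix of $x$. *Model.* A RAM with words of $w$ bits: arithmetic, bitwise operations, shifts, comparisons,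 most significant bit, reading $S[i]$, and evaluation of a stored static function each take one step. An $r$-bit static function on $k$ keys may be stored in $rk+ck+o(k)$ bits ($c\ge0$ a constant); it returns arbitrary $r$-bit values outside its domain. *Index.* The following static functions are stored: (i) $h_\alpha\mapsto|n_\alpha|$ for internal nodes $\alpha$; (ii) $p\mapsto|n_{\mathrm{exit}(p)}|$ for $p\in P$, where $P$ contains, for each internal node $\alpha$, the prefix of $e_\alpha$ whose length is the smallest power of two in the skip interval of $\alpha$ (if there is one); (iii) the static functions of a range locator, from which one computes in constant time, for each name $n_\alpha$, the smallest and largest indices $\mathrm{left}(n_\alpha),\mathrm{right}(n_\alpha)$ of elements of $S$ prefixed by $n_\alpha$. Given these, put $\mathrm{extent}(p)=$ the longest common prefix of $S[\mathrm{left}(p)]$ and $S[\mathrm{right}(p)]$. Let $T(h)=\mathrm{extent}(h[0..g))$, where $g$ is the value of (i) at $h$. Let $\hat f(p)=t$, where $t$ is the value of (ii) at $p$, if $t\le|p|$ and $p$ is a prefix of $\mathrm{extent}(p[0..t))$, and $\hat f(p)=\bot$ otherwise. *Fat binary search* $\mathrm{FBS}^-(x,a,b)$. While $b-a>1$: let $f$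 be the 2-fattest number in the open interval $(a..b)$ and $e=T(x[0..f))$; if $f\le|e|$ and $e$ is a proper prefix of $x$, set $a\leftarrow|e|$, else set $b\leftarrow f$. Then let $t=0$ if $a=0$ and the extent of the root is nonempty, and $t=a+1$ otherwise. With $e=\mathrm{extent}(x[0..t))$, return $\mathrm{left}(x[0..t))-1$ if $x=e$ or the first bit at which $x$ and $e$ differ is $0$ in $x$, and return $\mathrm{right}(x[0..t))$ otherwise. *The long-distance algorithm.* Start with $a=0$. While $a<w/2$: let $m$ be the least power of two larger than $a$ and $t=\hat f(x[0..m))$; if $t=\bot$, return $\mathrm{FBS}^-(x,a,m)$; let $p=x[0..t)$; if $S[\mathrm{left}(p)]\ge x$, return $\mathrm{left}(p)-1$; if $S[\mathrm{right}(p)]<x$, return $\mathrm{right}(p)$; set $a\leftarrow|\mathrm{extent}(p)|$. When the loop ends, return $\mathrm{FBS}^-(x,a,w)$. **Theorem.** Whatever values the stored static functions return outside their domains, for every binary string $x$ of length $w$ the long-distance algorithm returns the index $i$ with $S[i]=x^-$ (or $-1$ if $x$ has no predecessor in $S$), and it does so in time $O(\log(w-\log D(x,S)))$. Its index takes $O(n\log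 w)$ bits, in addition to the space needed to store $S$. The constant in the time bound is absolute; the constant in the space bound depends only on $c$ and on the $o(k)$ term. -/

import Mathlib

open Filter Asymptotics

namespace LongDist

/-! ## Logarithm and distance -/

/-- The binary logarithm, with the convention `log y = 1` whenever `y < 2`. -/
noncomputable def lg (y : ℝ) : ℝ := if y < 2 then 1 else Real.logb 2 y

/-- The long distance `D(x, S) = max {x⁺ - x, x - x⁻}` where `x⁺ = min {y ∈ S | x ≤ y}` and
`x⁻ = max {y ∈ S | y < x}`; a term whose `x⁺` or `x⁻` does not exist is left out
(it contributes `0`). -/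
def longDistance (S : Finset ℕ) (x : ℕ) : ℕ :=
  max ((S.filter (fun y => x ≤ y)).min.untopD x - x)
    (x - (S.filter (fun y => y < x)).max.unbotD x)

/-- The `i`-th element `S[i]` of `S` in increasing order, counting from `0`. -/
def nth (S : Finset ℕ) (i : ℕ) : ℕ := (S.sort (· ≤ ·)).getD i 0

/-- `r` is a correct answer to the predecessor query `x`: it is the index `i` with `S[i] = x⁻`, or
`none` (the value `-1`) if `x` has no predecessor in `S`. -/
def IsPredIndex (S : Finset ℕ) (x : ℕ) : Option ℕ → Prop
  | none => ∀ y ∈ S, x ≤ y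
  | some i => i < S.card ∧ IsGreatest {y | y ∈ S ∧ y < x} (nth S i)

/-! ## Binary strings and the compacted trie

A binary string is a pair (length, value of the string read as a binary number).  A string of
length `w` is therefore the same as a number smaller than `2 ^ w`, and the lexicographic order on
such strings is the order of numbers. -/

abbrev BStr := ℕ × ℕ

/-- The substring `e[0..l)`, for `l ≤ |e|`. -/
def take (e : BStr) (l : ℕ) : BStr := (l, e.2 / 2 ^ (e.1 - l))

/-- The order `p ≼ q`: the string `p` begins `q`. -/
def Begins (p q : BStr) : Prop := p.1 ≤ q.1 ∧ take q p.1 = p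

instance : DecidableRel Begins := fun _ _ => inferInstanceAs (Decidable (_ ∧ _))

/-- The set `Pref S` of all strings that begin some element of `S`. -/
def prefs (w : ℕ) (S : Finset ℕ) : Finset BStr :=
  (Finset.range (w + 1)).biUnion fun l => S.image fun y => take (w, y) l

/-- The nodes of the compacted trie on `S` are given by their extents.  The extents of the
internal nodes are the strings at which the trie branches. -/
def internals (w : ℕ) (S : Finset ℕ) : Finset BStr :=
  (prefs w S).filter fun p =>
    (p.1 + 1, 2 * p.2) ∈ prefs w S ∧ (p.1 + 1, 2 * p.2 + 1) ∈ prefs w S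

/-- The extents of all nodes; the extents of the external nodes are the elements of `S`. -/
def nodes (w : ℕ) (S : Finset ℕ) : Finset BStr :=
  internals w S ∪ S.image fun y => (w, y)

/-- The length `|n_α|` of the name of the node with extent `e`: the name of the root is empty, the
name of any other node is one bit longer than the extent of its parent. -/
def nameLen (w : ℕ) (S : Finset ℕ) (e : BStr) : ℕ :=
  ((internals w S).filter fun p => Begins p e ∧ p ≠ e).sup fun p => p.1 + 1

/-- The name `n_α` of the node with extent `e`. -/
def name (w : ℕ) (S : Finset ℕ) (e : BStr) : BStr := take e (nameLen w S e)

/-- The skip interval: `[1..|e_α|]` for the root, `[|n_α|..|e_α|]` for all other nodes. -/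
def skip (w : ℕ) (S : Finset ℕ) (e : BStr) : Finset ℕ :=
  Finset.Icc (max 1 (nameLen w S e)) e.1

/-- The 2-fattest number of an interval of positive integers, `0` if the interval is empty. -/
def twoFattest (I : Finset ℕ) : ℕ :=
  (I.filter fun f => ∀ g ∈ I, padicValNat 2 g ≤ padicValNat 2 f).sup id

/-- The handle `h_α` of the node with extent `e`. -/
def handle (w : ℕ) (S : Finset ℕ) (e : BStr) : BStr := take e (twoFattest (skip w S e))

/-- The exit node of a string `p`: the node `α` such that `n_α ≼ p` and either `e_α = p`
or `e_α` does not begin `p` (as a set of extents, which has one element). -/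
def exitNodes (w : ℕ) (S : Finset ℕ) (p : BStr) : Finset BStr :=
  (nodes w S).filter fun e => Begins (name w S e) p ∧ (e = p ∨ ¬ Begins e p)

/-- The set `P`: every internal extent is cut to the smallest power of two (if any) in the skip
interval of its node. -/
def cuts (w : ℕ) (S : Finset ℕ) : Finset BStr :=
  (internals w S).biUnion fun e =>
    ((skip w S e).filter fun m => (∃ k ∈ Finset.range (w + 1), m = 2 ^ k) ∧
      ∀ k ∈ Finset.range (w + 1), 2 ^ k ∈ skip w S e → m ≤ 2 ^ k).image (take e)

/-! ## The index

The index is a family of static functions from strings to fixed-width integers. -/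

/-- The static functions of the index.  `handleMap` is the function `g` of the z-fast trie,
`cutMap` is the function `f` on the set `P` of cut extents, and the other ones form the range
locator: for `right = false` they find the smallest index `left(n_α)` and for `right = true` the
largest index `right(n_α)` of an element of `S` that the name `n_α` begins. -/
inductive Table
  | handleMap
  | cutMap
  | lcpMap (right : Bool)
  | offsetMap (right : Bool)
  | baseMap (right : Bool)

def allTables : List Table :=
  [.handleMap, .cutMap, .lcpMap false, .offsetMap false, .baseMap false,
    .lcpMap true, .offsetMap true, .baseMap true]

/-- The smallest (`n_α 00…0`) or largest (`n_α 11…1`) string of length `w` that a name begins,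
for all names. -/
def ends (w : ℕ) (S : Finset ℕ) : Bool → Finset ℕ
  | false => ((nodes w S).image (name w S)).image fun p => p.2 * 2 ^ (w - p.1)
  | true => ((nodes w S).image (name w S)).image fun p => (p.2 + 1) * 2 ^ (w - p.1) - 1

/-- The index to be found for an element of `ends`. -/
def rank (S : Finset ℕ) : Bool → ℕ → ℕ
  | false, d => (S.filter fun y => y < d).card
  | true, d => (S.filter fun y => y ≤ d).card - 1

/-- The set `ends`, in increasing order, is divided into buckets of this size. -/
def bucketSize (S : Finset ℕ) : ℕ := Nat.size S.card

def bucketNo (w : ℕ) (S : Finset ℕ) (right : Bool) (d : ℕ) : ℕ :=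
  ((ends w S right).filter fun d' => d' < d).card / bucketSize S

/-- The bucket of `d`. -/
def bucket (w : ℕ) (S : Finset ℕ) (right : Bool) (d : ℕ) : Finset ℕ :=
  (ends w S right).filter fun d' => bucketNo w S right d' = bucketNo w S right d

/-- The length of the longest common prefix of the bucket of `d`. -/
def bucketLcp (w : ℕ) (S : Finset ℕ) (right : Bool) (d : ℕ) : ℕ :=
  Nat.findGreatest (fun l => ∀ d' ∈ bucket w S right d, take (w, d') l = take (w, d) l) w

/-- The rank of the first element of the bucket of `d`. -/
def bucketBase (w : ℕ) (S : Finset ℕ) (right : Bool) (d : ℕ) : ℕ :=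
  rank S right ((bucket w S right d).min.untopD 0)

/-- The set of keys of a static function of the index. -/
def keys (w : ℕ) (S : Finset ℕ) : Table → Finset BStr
  | .handleMap => (internals w S).image (handle w S)
  | .cutMap => cuts w S
  | .lcpMap r => (ends w S r).image fun d => (w, d)
  | .offsetMap r => (ends w S r).image fun d => (w, d)
  | .baseMap r => (ends w S r).image fun d => take (w, d) (bucketLcp w S r d)

/-- The value of a static function of the index on one of its keys.  Each supremum is over objects
of which only one has the given key. -/
def value (w : ℕ) (S : Finset ℕ) : Table → BStr → ℕ
  | .handleMap, p => ((internals w S).filter fun e => handle w S e = p).sup (nameLen w S)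
  | .cutMap, p => (exitNodes w S p).sup (nameLen w S)
  | .lcpMap r, p => bucketLcp w S r p.2
  | .offsetMap r, p => rank S r p.2 - bucketBase w S r p.2
  | .baseMap r, p => ((ends w S r).filter fun d => take (w, d) (bucketLcp w S r d) = p).sup
      (bucketBase w S r)

/-- The number of bits of the values of a static function of the index. -/
def width (w : ℕ) (S : Finset ℕ) : Table → ℕ
  | .handleMap => Nat.size w
  | .cutMap => Nat.size w
  | .lcpMap _ => Nat.size w
  | .offsetMap _ => Nat.size (bucketSize S - 1)
  | .baseMap _ => Nat.size (S.card - 1)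

/-- `F` is what one may read off the stored static functions: the right value on every key, and
arbitrary values of the right width on all other strings. -/
def Stores (w : ℕ) (S : Finset ℕ) (F : Table → BStr → ℕ) : Prop :=
  ∀ T, (∀ p, F T p < 2 ^ width w S T) ∧ ∀ p ∈ keys w S T, F T p = value w S T p

/-- The size of the index in bits if an `r`-bit static function on `k` keys takes `bits k r`
bits. -/
def indexBits (bits : ℕ → ℕ → ℕ) (w : ℕ) (S : Finset ℕ) : ℕ :=
  (allTables.map fun T => bits (keys w S T).card (width w S T)).sum

/-! ## The machine

A random access machine with words of `w` bits.  It knows `S` only through the instruction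
`access i` (read `S[i]`), and the index only through `lookup T l v` (evaluate a static function at
the string of length `l` and value `v`). -/

inductive Instr
  | add (a b : ℕ)
  | sub (a b : ℕ)
  | mul (a b : ℕ)
  | and (a b : ℕ)
  | or (a b : ℕ)
  | xor (a b : ℕ)
  | shl (a b : ℕ)
  | shr (a b : ℕ)
  | size (a : ℕ)
  | lt (a b : ℕ)
  | le (a b : ℕ)
  | eq (a b : ℕ)
  | access (i : ℕ)
  | lookup (T : Table) (l v : ℕ)

/-- The word returned by an instruction.  Arithmetic is modulo `2 ^ w`, tests return `1` or `0`, and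
`size a` is the position of the most significant one of `a`, counting from `1`
(`0` if `a = 0`). -/
def Instr.result (w : ℕ) (S : Finset ℕ) (F : Table → BStr → ℕ) : Instr → ℕ
  | .add a b => (a + b) % 2 ^ w
  | .sub a b => (a + 2 ^ w - b) % 2 ^ w
  | .mul a b => (a * b) % 2 ^ w
  | .and a b => a &&& b
  | .or a b => a ||| b
  | .xor a b => a ^^^ b
  | .shl a b => (a * 2 ^ b) % 2 ^ w
  | .shr a b => a / 2 ^ b
  | .size a => Nat.size a
  | .lt a b => if a < b then 1 else 0
  | .le a b => if a ≤ b then 1 else 0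
  | .eq a b => if a = b then 1 else 0
  | .access i => nth S i
  | .lookup T l v => F T (l, v)

/-- A program either returns, or executes an instruction and continues according to the word that
the instruction returned, or diverges. -/
inductive RAM (α : Type) : Type
  | ret (a : α) : RAM α
  | step (i : Instr) (next : ℕ → RAM α) : RAM α
  | diverge : RAM α

namespace RAM

def bind {α β : Type} : RAM α → (α → RAM β) → RAM β
  | ret a, f => f a
  | step i next, f => step i fun v => bind (next v) f
  | diverge, _ => diverge

instance : Monad RAM where
  pure := ret
  bind := bind

/-- The result of a program and its running time, the number of executed instructions. -/
def run {α : Type} (w : ℕ) (S : Finset ℕ) (F : Table → BStr → ℕ) : RAM α → Option (α × ℕ)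
  | ret a => some (a, 0)
  | step i next => (run w S F (next (i.result w S F))).map fun o => (o.1, o.2 + 1)
  | diverge => none

end RAM

def exec (i : Instr) : RAM ℕ := .step i .ret

def test (i : Instr) : RAM Bool := .step i fun v => .ret (v == 1)

/-- A loop: the body either changes the state (`inl`) or leaves the loop (`inr`).  A loop that has
not been left after the given number of rounds counts as divergent. -/
def loop {σ β : Type} (body : σ → RAM (σ ⊕ β)) : ℕ → σ → RAM β
  | 0, _ => .diverge
  | k + 1, s => do
    match ← body s with
    | .inl s' => loop body k s'
    | .inr b => return b

/-! ## The algorithm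

In the programs, `w` is the word length and `n` is the number of elements of `S`. -/

/-- The string `(l, v)` cut to length `m`. -/
def takeP (l v m : ℕ) : RAM ℕ := do
  let s ← exec (.sub l m)
  exec (.shr v s)

/-- The test `p ≼ q`. -/
def beginsP (p q : BStr) : RAM Bool := do
  if ← test (.le p.1 q.1) then
    let v ← takeP q.1 q.2 p.1
    test (.eq v p.2)
  else return false

/-- The rank of `d`, from the bucket and the offset in it; it is cut down to `n - 1`, so that it is
the index of an element of `S` whatever the static functions return. -/
def rankP (w n : ℕ) (right : Bool) (d : ℕ) : RAM ℕ := do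
  let l ← exec (.lookup (.lcpMap right) w d)
  let o ← exec (.lookup (.offsetMap right) w d)
  let v ← takeP w d l
  let b ← exec (.lookup (.baseMap right) l v)
  let i ← exec (.add b o)
  if ← test (.lt (n - 1) i) then return n - 1 else return i

/-- `left(p)`: the smallest index of an element of `S` that the name `p` begins. -/
def leftP (w n : ℕ) (p : BStr) : RAM ℕ := do
  let s ← exec (.sub w p.1)
  let d ← exec (.shl p.2 s)
  rankP w n false d

/-- `right(p)`: the largest index of an element of `S` that the name `p` begins. -/
def rightP (w n : ℕ) (p : BStr) : RAM ℕ := do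
  let s ← exec (.sub w p.1)
  let d ← exec (.shl p.2 s)
  let u ← exec (.shl 1 s)
  let u ← exec (.sub u 1)
  let d ← exec (.add d u)
  rankP w n true d

/-- `extent(p)`: the longest common prefix of `S[left(p)]` and `S[right(p)]`. -/
def extentP (w n : ℕ) (p : BStr) : RAM BStr := do
  let i ← leftP w n p
  let j ← rightP w n p
  let y ← exec (.access i)
  let z ← exec (.access j)
  let u ← exec (.xor y z)
  let k ← exec (.size u)
  let l ← exec (.sub w k)
  let v ← takeP w y l
  return (l, v)

/-- The z-fast trie: the function `T`, mapping the handle of an internal node to its extent. -/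
def zfastP (w n : ℕ) (h : BStr) : RAM BStr := do
  let t ← exec (.lookup .handleMap h.1 h.2)
  let v ← takeP h.1 h.2 t
  extentP w n (t, v)

/-- The function `f`, patched: the length of the name of the exit node of `p` if `p` is one of the
cut extents, `none` if `p` does not begin any element of `S`. -/
def fHatP (w n : ℕ) (p : BStr) : RAM (Option ℕ) := do
  let t ← exec (.lookup .cutMap p.1 p.2)
  if ← test (.le t p.1) then
    let v ← takeP p.1 p.2 t
    let e ← extentP w n (t, v)
    if ← beginsP p e then return some t else return none
  else return none

/-- The 2-fattest number in the open interval `(a..b)`, namely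
`(-1 ≪ msb (a ⊕ (b - 1))) & (b - 1)`. -/
def fattestP (a b : ℕ) : RAM ℕ := do
  let r ← exec (.sub b 1)
  let u ← exec (.xor a r)
  let k ← exec (.size u)
  let k ← exec (.sub k 1)
  let r ← exec (.shr r k)
  exec (.shl r k)

/-- Fat binary search: the length of the name of the exit node of `x`, starting from the interval
`(a..b)`. -/
def fbsP (w n x a b : ℕ) : RAM ℕ := do
  let a ← loop (fun (s : ℕ × ℕ) => do
    let (a, b) := s
    let d ← exec (.sub b a)
    if ← test (.lt 1 d) then
      let f ← fattestP a b
      let v ← takeP w x f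
      let e ← zfastP w n (f, v)
      if ← test (.le f e.1) then
        if ← test (.lt e.1 w) then
          if ← beginsP e (w, x) then return .inl (e.1, b) else return .inl (a, f)
        else return .inl (a, f)
      else return .inl (a, f)
    else return .inr a) (w + 1) (a, b)
  let root ← extentP w n (0, 0)
  if ← test (.eq a 0) then
    if ← test (.eq root.1 0) then exec (.add a 1) else return 0
  else exec (.add a 1)

/-- `i - 1`, where `none` stands for `-1`. -/
def decP (i : ℕ) : RAM (Option ℕ) := do
  if ← test (.eq i 0) then return none
  else
    let j ← exec (.sub i 1)
    return some j

/-- `pred(x, t)`: the index of the predecessor of `x`, where `t` is the length of the name of its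
exit node.  Since the extent `e` of the exit node is equal to `x` or does not begin `x`,
one has `x[0..|e|) ≤ e` if and only if `x` begins `e` or has a `0` at the first bit
where `x` and `e` differ. -/
def predP (w n x t : ℕ) : RAM (Option ℕ) := do
  let v ← takeP w x t
  let e ← extentP w n (t, v)
  let u ← takeP w x e.1
  if ← test (.le u e.2) then
    let i ← leftP w n (t, v)
    decP i
  else
    let j ← rightP w n (t, v)
    return some j

/-- `FBS⁻(x, a, b)`: fat binary search followed by `pred`. -/
def fbsPredP (w n x a b : ℕ) : RAM (Option ℕ) := do
  let t ← fbsP w n x a b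
  predP w n x t

/-- The long-distance predecessor algorithm. -/
def longPredP (w n x : ℕ) : RAM (Option ℕ) :=
  loop (fun a => do
    let c ← exec (.add a a)
    if ← test (.lt c w) then
      -- the least power of two larger than a
      let k ← exec (.size a)
      let m ← exec (.shl 1 k)
      let v ← takeP w x m
      match ← fHatP w n (m, v) with
      | none =>
        let r ← fbsPredP w n x a m
        return .inr r
      | some t =>
        let p ← takeP w x t
        let i ← leftP w n (t, p)
        let y ← exec (.access i)
        if ← test (.le x y) then
          let r ← decP i
          return .inr r
        else
          let j ← rightP w n (t, p)
          let z ← exec (.access j)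
          if ← test (.lt z x) then return .inr (some j)
          else
            let e ← extentP w n (t, p)
            return .inl e.1
    else
      let r ← fbsPredP w n x a w
      return .inr r) (w + 1) 0

end LongDist

/-!
Correctness rests on three facts about the compacted trie.  Every string that begins an element of
`S` lies between the name and the extent of exactly one node (`exists_locus`, `node_unique`); the
name of a node begins the same elements of `S` as its extent (`begins_of_name_begins`); and the
longest common prefix of the smallest and the largest of these elements is the extent
(`IsRange.lcp_eq`).  Since distinct buckets of the range locator have distinct longest common
prefixes (`bucketNo_eq_of_take_eq`), `left`, `right` and `extent` are right at every name
(`nth_name`).  Elsewhere the indices may be arbitrary, but `extent` is still the longest common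
prefix of two elements of `S`; so if it is shorter than `w`, it is the extent of an internal node
(`extentVal_mem_internals`).  Hence a positive test of fat binary search is always right.  A
negative test is right because the 2-fattest number of the search interval, if it falls in the skip
interval of a node above `x`, is the length of the handle of this node (`lt_fattest_of_anc`).

The long-distance algorithm looks up the prefix of `x` whose length `m` is the least power of two
larger than `a`, where `a` is `0` or the length of an internal extent that begins `x`.  If this
prefix belongs to the skip interval of an internal node, then it is the cut extent of that node, and
the stored value is accepted.  If a value is accepted, then either it is the right one, or only one
element of `S` begins with the string looked up, and acceptance forces `left` and `right` to be the
index of this element (`exists_isRange_of_accepts`).  In both cases the comparisons of `x` with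
`S[left]` and `S[right]` decide about the predecessor.  If a value is rejected, all internal
extents that begin `x` are shorter than `m` (`lt_of_not_accepts`), so that fat binary search may
take over.

For the running time, if `S[left] < x ≤ S[right]` and the extent has length `a`, then
`D(x, S) < 2 ^ (w - a)`, so `a ≤ w - log D(x, S)`.  Each round adds a bit to `a`, so there are
`O(log (w - log D(x, S)))` rounds; the final fat binary search has a right border of at most
`max 1 (2 * a)` and takes as many rounds as there are bits in which the borders may differ.

For the space, the trie has at most `2 n` nodes, and all values have `O(log w)` bits, with the
exception of the bases of the buckets; these have `O(log n)` bits, but there are only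
`O(n / log n)` of them (`width_mul_card_keys_le`).
-/

namespace LongDist

/-! ### Running time of programs -/

/-- The program terminates after at most `t` instructions, with a result that satisfies `Q`. -/
def Runs {α : Type} (w : ℕ) (S : Finset ℕ) (F : Table → BStr → ℕ) (p : RAM α) (t : ℕ)
    (Q : α → Prop) : Prop :=
  ∃ r t', p.run w S F = some (r, t') ∧ t' ≤ t ∧ Q r

section
variable {α β σ : Type} {w : ℕ} {S : Finset ℕ} {F : Table → BStr → ℕ}

theorem run_bind (p : RAM α) (f : α → RAM β) :
    (p >>= f).run w S F =
      (p.run w S F).bind fun o => ((f o.1).run w S F).map fun o' => (o'.1, o'.2 + o.2) := by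
  induction p with
  | ret a =>
    change (f a).run w S F = _
    simp [RAM.run]
  | step i next ih =>
    change ((next _ >>= f).run w S F).map _ = _
    rw [ih]
    simp only [RAM.run]
    cases (next (i.result w S F)).run w S F with
    | none => rfl
    | some o =>
      simp only [Option.bind_some, Option.map_some, Option.map_map]
      congr 1
  | diverge => rfl

theorem Runs.bind {p : RAM α} {f : α → RAM β} {t u : ℕ} {P : α → Prop} {Q : β → Prop}
    (hp : Runs w S F p t P) (hf : ∀ a, P a → Runs w S F (f a) u Q) :
    Runs w S F (p >>= f) (t + u) Q := by
  obtain ⟨r, t', h, ht, hr⟩ := hp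
  obtain ⟨r', u', h', hu, hr'⟩ := hf r hr
  exact ⟨r', u' + t', by simp [run_bind, h, h'], by omega, hr'⟩

theorem Runs.pure {a : α} {t : ℕ} {Q : α → Prop} (h : Q a) :
    Runs w S F (Pure.pure a : RAM α) t Q :=
  ⟨a, 0, rfl, Nat.zero_le _, h⟩

theorem Runs.mono {p : RAM α} {t u : ℕ} {P Q : α → Prop} (h : Runs w S F p t P) (htu : t ≤ u)
    (hPQ : ∀ a, P a → Q a) : Runs w S F p u Q := by
  obtain ⟨r, t', h, ht, hr⟩ := h
  exact ⟨r, t', h, ht.trans htu, hPQ r hr⟩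

theorem Runs.exec (i : Instr) : Runs w S F (exec i) 1 (· = i.result w S F) :=
  ⟨_, 1, rfl, le_rfl, rfl⟩

theorem Runs.exec_bind {i : Instr} {f : ℕ → RAM β} {t : ℕ} {Q : β → Prop}
    (h : Runs w S F (f (i.result w S F)) t Q) :
    Runs w S F (LongDist.exec i >>= f) (t + 1) Q := by
  rw [Nat.add_comm]
  refine (Runs.exec i).bind ?_
  rintro _ rfl
  exact h

theorem Runs.test (i : Instr) :
    Runs w S F (test i) 1 (· = (i.result w S F == 1)) :=
  ⟨_, 1, rfl, le_rfl, rfl⟩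

theorem Runs.test_bind {i : Instr} {f : Bool → RAM β} {t : ℕ} {Q : β → Prop}
    (h : Runs w S F (f (i.result w S F == 1)) t Q) :
    Runs w S F (LongDist.test i >>= f) (t + 1) Q := by
  rw [Nat.add_comm]
  refine (Runs.test i).bind ?_
  rintro _ rfl
  exact h

theorem Runs.ite_bool {b : Bool} {c : Prop} (hb : b = true ↔ c)
    {p q : RAM β} {t : ℕ} {Q : β → Prop}
    (hp : c → Runs w S F p t Q) (hq : ¬ c → Runs w S F q t Q) :
    Runs w S F (if b = true then p else q) t Q := by
  by_cases h : b = true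
  · rw [if_pos h]; exact hp (hb.1 h)
  · rw [if_neg h]; exact hq (mt hb.2 h)

theorem Runs.test_ite {i : Instr} {c : Prop} [Decidable c]
    (hi : i.result w S F = if c then 1 else 0) {p q : RAM β} {t : ℕ} {Q : β → Prop}
    (hp : c → Runs w S F p t Q) (hq : ¬ c → Runs w S F q t Q) :
    Runs w S F (LongDist.test i >>= fun b => if b = true then p else q) (t + 1) Q := by
  refine Runs.test_bind (Runs.ite_bool ?_ hp hq)
  rw [hi]
  split_ifs with hc <;> simp [hc]

theorem Runs.loop_succ {body : σ → RAM (σ ⊕ β)} {k : ℕ} {s : σ} {t u : ℕ} {P : σ ⊕ β → Prop}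
    {Q : β → Prop} (hb : Runs w S F (body s) t P)
    (hl : ∀ s', P (.inl s') → Runs w S F (loop body k s') u Q) (hr : ∀ b, P (.inr b) → Q b) :
    Runs w S F (loop body (k + 1) s) (t + u) Q := by
  refine hb.bind ?_
  rintro (s' | b) h
  · exact hl s' h
  · exact Runs.pure (hr b h)

end

/-! ### Words computed by the programs -/

/-- The word computed by `takeP`.  If `m` exceeds `l`, the length of the shift wraps around. -/
def takeVal (w l v m : ℕ) : ℕ := v / 2 ^ ((l + 2 ^ w - m) % 2 ^ w)

/-- The index computed by `rankP`, whatever the static functions return. -/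
def rankVal (w : ℕ) (S : Finset ℕ) (F : Table → BStr → ℕ) (right : Bool) (d : ℕ) : ℕ :=
  min (S.card - 1)
    ((F (.baseMap right) (F (.lcpMap right) (w, d), takeVal w w d (F (.lcpMap right) (w, d))) +
      F (.offsetMap right) (w, d)) % 2 ^ w)

/-- The index computed by `leftP`, which is `left(p)` if `p` is a name. -/
def leftVal (w : ℕ) (S : Finset ℕ) (F : Table → BStr → ℕ) (p : BStr) : ℕ :=
  rankVal w S F false (p.2 * 2 ^ ((w + 2 ^ w - p.1) % 2 ^ w) % 2 ^ w)

/-- The index computed by `rightP`, which is `right(p)` if `p` is a name. -/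
def rightVal (w : ℕ) (S : Finset ℕ) (F : Table → BStr → ℕ) (p : BStr) : ℕ :=
  rankVal w S F true ((p.2 * 2 ^ ((w + 2 ^ w - p.1) % 2 ^ w) % 2 ^ w +
    (1 * 2 ^ ((w + 2 ^ w - p.1) % 2 ^ w) % 2 ^ w + 2 ^ w - 1) % 2 ^ w) % 2 ^ w)

/-- The longest common prefix of the strings `y` and `z` of length `w`: the `w` bits without those
up to the most significant bit in which `y` and `z` differ. -/
def lcp (w y z : ℕ) : BStr := take (w, y) (w - Nat.size (y ^^^ z))

/-- The string computed by `extentP`, which is the extent of a node if `p` is its name. -/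
def extentVal (w : ℕ) (S : Finset ℕ) (F : Table → BStr → ℕ) (p : BStr) : BStr :=
  lcp w (nth S (leftVal w S F p)) (nth S (rightVal w S F p))

section
variable {w : ℕ} {S : Finset ℕ} {F : Table → BStr → ℕ}

/-- Subtraction does not wrap around if the result is not negative. -/
theorem sub_mod_word {l m : ℕ} (hl : l < 2 ^ w) (hm : m ≤ l) : (l + 2 ^ w - m) % 2 ^ w = l - m := by
  rw [show l + 2 ^ w - m = l - m + 2 ^ w by omega, Nat.add_mod_right, Nat.mod_eq_of_lt (by omega)]

theorem takeVal_eq {l v m : ℕ} (hl : l ≤ w) (hm : m ≤ l) : takeVal w l v m = v / 2 ^ (l - m) := by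
  rw [takeVal, sub_mod_word (hl.trans_lt w.lt_two_pow_self) hm]

theorem runs_takeP (l v m : ℕ) : Runs w S F (takeP l v m) 2 (· = takeVal w l v m) :=
  Runs.exec_bind (Runs.exec _)

theorem runs_rankP (right : Bool) (d : ℕ) :
    Runs w S F (rankP w S.card right d) 7 (· = rankVal w S F right d) := by
  refine Runs.exec_bind (Runs.exec_bind ((runs_takeP w d _).bind (u := 3) ?_))
  rintro _ rfl
  refine Runs.exec_bind (Runs.exec_bind (Runs.test_ite (t := 0) rfl (fun h => ?_) fun h => ?_))
  · exact Runs.pure (by simp only [Instr.result] at h; simp only [rankVal]; omega)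
  · exact Runs.pure (by simp only [Instr.result] at h; simp only [rankVal, Instr.result]; omega)

theorem runs_leftP (p : BStr) : Runs w S F (leftP w S.card p) 9 (· = leftVal w S F p) :=
  Runs.exec_bind (Runs.exec_bind (runs_rankP _ _))

theorem runs_rightP (p : BStr) : Runs w S F (rightP w S.card p) 12 (· = rightVal w S F p) :=
  Runs.exec_bind (Runs.exec_bind (Runs.exec_bind (Runs.exec_bind (Runs.exec_bind
    (runs_rankP _ _)))))

theorem nth_mem {i : ℕ} (hi : i < S.card) : nth S i ∈ S := by
  have h : i < (S.sort (· ≤ ·)).length := by simpa using hi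
  rw [nth, List.getD_eq_getElem _ _ h]
  exact (Finset.mem_sort _).1 (List.getElem_mem h)

theorem rankVal_lt (hS : S.Nonempty) (right : Bool) (d : ℕ) : rankVal w S F right d < S.card := by
  have := hS.card_pos
  simp only [rankVal]; omega

theorem nth_leftVal_mem (hS : S.Nonempty) (p : BStr) : nth S (leftVal w S F p) ∈ S :=
  nth_mem (rankVal_lt hS _ _)

theorem nth_rightVal_mem (hS : S.Nonempty) (p : BStr) : nth S (rightVal w S F p) ∈ S :=
  nth_mem (rankVal_lt hS _ _)

theorem size_xor_le {y z : ℕ} (hy : y < 2 ^ w) (hz : z < 2 ^ w) : Nat.size (y ^^^ z) ≤ w :=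
  Nat.size_le.2 (Nat.xor_lt_two_pow hy hz)

theorem runs_extentP (hS : S.Nonempty) (hw : ∀ y ∈ S, y < 2 ^ w) (p : BStr) :
    Runs w S F (extentP w S.card p) 28 (· = extentVal w S F p) := by
  refine (runs_leftP p).bind (u := 19) ?_
  rintro _ rfl
  refine (runs_rightP p).bind (u := 7) ?_
  rintro _ rfl
  refine Runs.exec_bind (Runs.exec_bind (Runs.exec_bind (Runs.exec_bind (Runs.exec_bind
    ((runs_takeP w _ _).bind (u := 0) ?_)))))
  rintro _ rfl
  refine Runs.pure ?_
  have h := size_xor_le (hw _ (nth_leftVal_mem (w := w) (F := F) hS p))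
    (hw _ (nth_rightVal_mem (w := w) (F := F) hS p))
  simp only [Instr.result, extentVal, lcp, take]
  rw [sub_mod_word w.lt_two_pow_self h, takeVal_eq le_rfl (Nat.sub_le _ _)]

theorem runs_zfastP (hS : S.Nonempty) (hw : ∀ y ∈ S, y < 2 ^ w) (h : BStr) :
    Runs w S F (zfastP w S.card h) 31
      (· = extentVal w S F (F .handleMap h, takeVal w h.1 h.2 (F .handleMap h))) := by
  refine Runs.exec_bind ((runs_takeP _ _ _).bind (u := 28) ?_)
  rintro _ rfl
  exact runs_extentP hS hw _

theorem begins_iff {p q : BStr} : Begins p q ↔ p.1 ≤ q.1 ∧ q.2 / 2 ^ (q.1 - p.1) = p.2 := by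
  simp [Begins, take, Prod.ext_iff]

theorem runs_beginsP {p q : BStr} (hq : q.1 ≤ w) :
    Runs w S F (beginsP p q) 4 (· = true ↔ Begins p q) := by
  refine Runs.test_ite (t := 3) rfl (fun h => ?_) (fun h => ?_)
  · refine (runs_takeP _ _ _).bind (u := 1) ?_
    rintro _ rfl
    refine (Runs.test _).mono le_rfl ?_
    rintro _ rfl
    rw [takeVal_eq hq h]
    simp only [Instr.result, begins_iff, h, true_and]
    split_ifs with h' <;> simp [h']
  · exact Runs.pure (by simp [begins_iff, h])

theorem runs_fHatP (hS : S.Nonempty) (hw : ∀ y ∈ S, y < 2 ^ w) (p : BStr) :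
    Runs w S F (fHatP w S.card p) 36 (· =
      if F .cutMap p ≤ p.1 ∧
        Begins p (extentVal w S F (F .cutMap p, takeVal w p.1 p.2 (F .cutMap p)))
      then some (F .cutMap p) else none) := by
  refine Runs.exec_bind (Runs.test_ite (t := 34) rfl (fun h => ?_) (fun h => ?_))
  · refine (runs_takeP _ _ _).bind (u := 32) ?_
    rintro _ rfl
    refine (runs_extentP hS hw _).bind (u := 4) ?_
    rintro _ rfl
    refine (runs_beginsP (Nat.sub_le _ _)).bind (u := 0) fun b hb => ?_
    exact Runs.ite_bool hb (fun hb => Runs.pure (if_pos ⟨h, hb⟩).symm)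
      fun hb => Runs.pure (if_neg fun h' => hb h'.2).symm
  · refine Runs.pure ?_
    simp only [Instr.result] at h
    rw [if_neg (fun h' => h h'.1)]

end

/-! ### Indices of the elements of `S` -/

section
variable {S : Finset ℕ}

theorem nth_lt_nth {i j : ℕ} (hij : i < j) (hj : j < S.card) : nth S i < nth S j := by
  have hj' : j < (S.sort (· ≤ ·)).length := by simpa using hj
  rw [nth, nth, List.getD_eq_getElem _ _ hj', List.getD_eq_getElem _ _ (hij.trans hj')]
  exact List.pairwise_iff_getElem.1 (Finset.sortedLT_sort S).pairwise i j _ hj' hij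

theorem exists_nth {y : ℕ} (hy : y ∈ S) : ∃ i < S.card, nth S i = y := by
  obtain ⟨i, hi, h⟩ := List.getElem_of_mem ((Finset.mem_sort (· ≤ ·)).2 hy)
  exact ⟨i, by simpa using hi, by rw [nth, List.getD_eq_getElem _ _ hi, h]⟩

theorem card_filter_lt_nth {i : ℕ} (hi : i < S.card) : (S.filter (· < nth S i)).card = i := by
  have : S.filter (· < nth S i) = (Finset.range i).image (nth S) := by
    ext y
    simp only [Finset.mem_filter, Finset.mem_image, Finset.mem_range]
    constructor
    · rintro ⟨hy, hlt⟩
      obtain ⟨j, hj, rfl⟩ := exists_nth hy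
      refine ⟨j, ?_, rfl⟩
      by_contra! h
      rcases h.eq_or_lt with rfl | h
      · exact lt_irrefl _ hlt
      · exact lt_asymm hlt (nth_lt_nth h hj)
    · rintro ⟨j, hj, rfl⟩
      exact ⟨nth_mem (hj.trans hi), nth_lt_nth hj hi⟩
  rw [this, Finset.card_image_of_injOn, Finset.card_range]
  intro a ha b hb hab
  simp only [Finset.coe_range, Set.mem_Iio] at ha hb
  rcases lt_trichotomy a b with h | h | h
  · exact absurd hab (nth_lt_nth h (hb.trans hi)).ne
  · exact h
  · exact absurd hab (nth_lt_nth h (ha.trans hi)).ne'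

/-- The index of `y` is the number of smaller elements. -/
theorem nth_card_filter_lt {y : ℕ} (hy : y ∈ S) : nth S (S.filter (· < y)).card = y := by
  obtain ⟨i, hi, rfl⟩ := exists_nth hy
  rw [card_filter_lt_nth hi]

theorem card_filter_lt_lt {y : ℕ} (hy : y ∈ S) : (S.filter (· < y)).card < S.card :=
  Finset.card_lt_card (Finset.filter_ssubset.2 ⟨y, hy, lt_irrefl y⟩)

/-- `i - 1`, where `none` stands for `-1`. -/
def decVal (i : ℕ) : Option ℕ := if i = 0 then none else some (i - 1)

/-- `decVal i` is the answer if `S[i]` is the smallest element not below `x`. -/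
theorem isPredIndex_decVal {x i : ℕ} (hi : i < S.card) (hx : x ≤ nth S i)
    (h : ∀ y ∈ S, y < nth S i → y < x) : IsPredIndex S x (decVal i) := by
  unfold decVal
  split_ifs with h0
  · intro y hy
    obtain ⟨j, hj, rfl⟩ := exists_nth hy
    rcases Nat.eq_zero_or_pos j with rfl | hj0
    · rwa [h0] at hx
    · exact hx.trans (h0 ▸ (nth_lt_nth hj0 hj).le)
  · refine ⟨by omega, ⟨nth_mem (by omega), h _ (nth_mem (by omega)) (nth_lt_nth (by omega) hi)⟩, ?_⟩
    rintro y ⟨hy, hyx⟩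
    obtain ⟨j, hj, rfl⟩ := exists_nth hy
    by_contra! hlt
    have : i ≤ j := by
      by_contra! hji
      rcases (show j ≤ i - 1 by omega).eq_or_lt with rfl | hji'
      · exact lt_irrefl _ hlt
      · exact lt_asymm hlt (nth_lt_nth hji' (by omega))
    rcases this.eq_or_lt with rfl | hij
    · omega
    · have := nth_lt_nth hij hj
      omega

theorem isPredIndex_some {x i : ℕ} (hi : i < S.card) (hx : nth S i < x)
    (h : ∀ y ∈ S, nth S i < y → x ≤ y) : IsPredIndex S x (some i) := by
  refine ⟨hi, ⟨nth_mem hi, hx⟩, ?_⟩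
  rintro y ⟨hy, hyx⟩
  by_contra! hlt
  have := h y hy hlt
  omega

end

/-! ### Strings -/

section
variable {w : ℕ} {S : Finset ℕ}

theorem Begins.refl (p : BStr) : Begins p p := by simp [begins_iff]

theorem Begins.le {p q : BStr} (h : Begins p q) : p.1 ≤ q.1 := h.1

theorem Begins.trans {p q r : BStr} (h : Begins p q) (h' : Begins q r) : Begins p r := by
  rw [begins_iff] at *
  refine ⟨h.1.trans h'.1, ?_⟩
  rw [← h.2, ← h'.2, Nat.div_div_eq_div_mul, ← pow_add]
  congr 2
  omega

theorem Begins.of_le {p q r : BStr} (hp : Begins p r) (hq : Begins q r) (h : p.1 ≤ q.1) :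
    Begins p q := by
  rw [begins_iff] at *
  refine ⟨h, ?_⟩
  rw [← hp.2, ← hq.2, Nat.div_div_eq_div_mul, ← pow_add]
  congr 2
  omega

theorem Begins.eq_of_length {p q : BStr} (h : Begins p q) (h' : q.1 ≤ p.1) : p = q := by
  rw [begins_iff] at h
  have : p.1 = q.1 := le_antisymm h.1 h'
  refine Prod.ext this ?_
  rw [← h.2, this]
  simp

theorem Begins.take_eq {p q : BStr} (h : Begins p q) : take q p.1 = p := h.2

theorem take_begins {q : BStr} {l : ℕ} (h : l ≤ q.1) : Begins (take q l) q := ⟨h, rfl⟩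

theorem begins_pair {l c v : ℕ} {q : BStr} (h : Begins (l + 1, c) q) (hc : c / 2 = v) :
    Begins (l, v) q := by
  refine Begins.trans (q := (l + 1, c)) ?_ h
  rw [begins_iff]
  simpa using hc

/-- The strings that begin with `p` form an interval. -/
theorem begins_of_mem_Icc {p : BStr} {x y z : ℕ} (hy : Begins p (w, y)) (hz : Begins p (w, z))
    (hyx : y ≤ x) (hxz : x ≤ z) : Begins p (w, x) := by
  rw [begins_iff] at *
  refine ⟨hy.1, le_antisymm ?_ ?_⟩
  · exact (Nat.div_le_div_right hxz).trans_eq hz.2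
  · exact hy.2.symm.trans_le (Nat.div_le_div_right hyx)

theorem lt_of_not_begins {p : BStr} {x y z : ℕ} (hx : Begins p (w, x)) (hy : Begins p (w, y))
    (hz : ¬ Begins p (w, z)) (h : z < y) : z < x := by
  by_contra! hxz
  exact hz (begins_of_mem_Icc hx hy hxz h.le)

theorem lt_of_begins_of_lt_of_not_begins {p : BStr} {x y z : ℕ} (hx : Begins p (w, x))
    (hy : Begins p (w, y)) (hz : ¬ Begins p (w, z)) (h : y < z) : x < z := by
  by_contra! hxz
  exact hz (begins_of_mem_Icc hy hx h.le hxz)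

theorem mem_prefs {p : BStr} : p ∈ prefs w S ↔ ∃ y ∈ S, Begins p (w, y) := by
  simp only [prefs, Finset.mem_biUnion, Finset.mem_range, Finset.mem_image]
  constructor
  · rintro ⟨l, hl, y, hy, rfl⟩
    exact ⟨y, hy, take_begins (by simpa using Nat.lt_succ_iff.1 hl)⟩
  · rintro ⟨y, hy, h⟩
    exact ⟨p.1, Nat.lt_succ_of_le h.le, y, hy, h.take_eq⟩

theorem mem_internals {p : BStr} : p ∈ internals w S ↔
    (∃ y ∈ S, Begins (p.1 + 1, 2 * p.2) (w, y)) ∧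
      ∃ y ∈ S, Begins (p.1 + 1, 2 * p.2 + 1) (w, y) := by
  simp only [internals, Finset.mem_filter, mem_prefs, and_iff_right_iff_imp]
  rintro ⟨⟨y, hy, h⟩, -⟩
  exact ⟨y, hy, begins_pair h (by omega)⟩

theorem length_lt_of_mem_internals {p : BStr} (hp : p ∈ internals w S) : p.1 < w := by
  obtain ⟨⟨y, -, h⟩, -⟩ := mem_internals.1 hp
  exact h.le

/-- A branching string is at least as long as any string that begins elements of both branches. -/
theorem length_le_of_begins_branches {p e : BStr} {y z : ℕ}
    (hy : Begins (p.1 + 1, 2 * p.2) (w, y)) (hz : Begins (p.1 + 1, 2 * p.2 + 1) (w, z))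
    (hey : Begins e (w, y)) (hez : Begins e (w, z)) : e.1 ≤ p.1 := by
  by_contra! h
  have h0 := hy.of_le hey h
  have h1 := hz.of_le hez h
  have := h0.take_eq.symm.trans h1.take_eq
  simp at this

theorem div_two_pow_eq_iff {y z k : ℕ} :
    y / 2 ^ k = z / 2 ^ k ↔ Nat.size (y ^^^ z) ≤ k := by
  rw [Nat.size_le, ← Nat.div_eq_zero_iff_lt (by positivity), Nat.xor_div_two_pow,
    Nat.xor_eq_zero_iff]

theorem begins_lcp {p : BStr} {y z : ℕ} (hs : Nat.size (y ^^^ z) ≤ w) :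
    Begins p (lcp w y z) ↔ Begins p (w, y) ∧ Begins p (w, z) := by
  have hz : Begins (lcp w y z) (w, z) := by
    rw [begins_iff]
    simp only [lcp, take]
    refine ⟨by omega, ?_⟩
    exact (div_two_pow_eq_iff.2 (by omega)).symm
  have hy : Begins (lcp w y z) (w, y) := take_begins (by simp)
  refine ⟨fun h => ⟨h.trans hy, h.trans hz⟩, fun ⟨h, h'⟩ => h.of_le hy ?_⟩
  rw [begins_iff] at h h'
  have := div_two_pow_eq_iff.1 (h.2.trans h'.2.symm)
  simp only [lcp, take] at *
  omega

theorem lcp_begins_left {y z : ℕ} : Begins (lcp w y z) (w, y) := take_begins (by simp)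

theorem lcp_begins_right {y z : ℕ} (hs : Nat.size (y ^^^ z) ≤ w) : Begins (lcp w y z) (w, z) :=
  ((begins_lcp hs).1 (Begins.refl _)).2

theorem lcp_self {y : ℕ} : lcp w y y = (w, y) := by simp [lcp, take]

theorem lcp_mem_internals {y z : ℕ} (hy : y ∈ S) (hz : z ∈ S) (hs : Nat.size (y ^^^ z) ≤ w)
    (hne : y ≠ z) : lcp w y z ∈ internals w S := by
  set k := Nat.size (y ^^^ z) with hk
  have hk0 : 0 < k := by
    rw [hk, Nat.size_pos, Nat.pos_iff_ne_zero, Ne, Nat.xor_eq_zero_iff]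
    exact hne
  obtain ⟨j, hj⟩ : ∃ j, k = j + 1 := ⟨k - 1, by omega⟩
  have h1 : y / 2 ^ k = z / 2 ^ k := div_two_pow_eq_iff.2 le_rfl
  have h2 : ¬ y / 2 ^ j = z / 2 ^ j := by
    rw [div_two_pow_eq_iff]; omega
  have e1 : y / 2 ^ k = y / 2 ^ j / 2 := by rw [hj, pow_succ, Nat.div_div_eq_div_mul]
  have e2 : z / 2 ^ k = z / 2 ^ j / 2 := by rw [hj, pow_succ, Nat.div_div_eq_div_mul]
  rw [mem_internals]
  simp only [begins_iff, lcp, take, ← hk, show w - (w - k + 1) = j by omega,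
    show w - (w - k) = k by omega]
  rcases Nat.mod_two_eq_zero_or_one (y / 2 ^ j) with h | h
  · exact ⟨⟨y, hy, by omega, by omega⟩, z, hz, by omega, by omega⟩
  · exact ⟨⟨z, hz, by omega, by omega⟩, y, hy, by omega, by omega⟩

/-! ### Nodes of the trie -/

theorem mem_nodes {e : BStr} : e ∈ nodes w S ↔ e ∈ internals w S ∨ ∃ y ∈ S, e = (w, y) := by
  simp [nodes, eq_comm]

theorem exists_begins_of_mem_nodes {e : BStr} (he : e ∈ nodes w S) :
    ∃ y ∈ S, Begins e (w, y) := by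
  rcases mem_nodes.1 he with h | ⟨y, hy, rfl⟩
  · exact mem_prefs.1 (Finset.mem_filter.1 h).1
  · exact ⟨y, hy, Begins.refl _⟩

/-- The name of a node is longer than the extents of its proper ancestors. -/
theorem lt_nameLen {p e : BStr} (hp : p ∈ internals w S) (hb : Begins p e) (h : p.1 < e.1) :
    p.1 < nameLen w S e :=
  Finset.le_sup (f := fun p : BStr => p.1 + 1)
    (Finset.mem_filter.2 ⟨hp, hb, fun h' => h.ne (congrArg Prod.fst h')⟩)

theorem nameLen_le_iff {e : BStr} {l : ℕ} : nameLen w S e ≤ l ↔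
    ∀ p ∈ internals w S, Begins p e → p ≠ e → p.1 < l := by
  simp [nameLen, Finset.sup_le_iff, Finset.mem_filter]

theorem nameLen_le_length (e : BStr) : nameLen w S e ≤ e.1 :=
  nameLen_le_iff.2 fun _ _ hb hne => lt_of_le_of_ne hb.le fun h => hne (hb.eq_of_length h.ge)

theorem name_begins (e : BStr) : Begins (name w S e) e := take_begins (nameLen_le_length e)

/-- The name of a node begins the same elements of `S` as the extent. -/
theorem begins_of_name_begins (hw : ∀ y ∈ S, y < 2 ^ w) {e : BStr} (he : e ∈ nodes w S) {z : ℕ}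
    (hz : z ∈ S) (h : Begins (name w S e) (w, z)) : Begins e (w, z) := by
  obtain ⟨y, hy, hey⟩ := exists_begins_of_mem_nodes he
  have hs : Nat.size (y ^^^ z) ≤ w := size_xor_le (hw y hy) (hw z hz)
  have hn : Begins (name w S e) (lcp w y z) := (begins_lcp hs).2 ⟨(name_begins e).trans hey, h⟩
  rcases le_or_gt e.1 (lcp w y z).1 with hl | hl
  · exact ((begins_lcp hs).1 (hey.of_le lcp_begins_left hl)).2
  · -- A branching prefix shorter than `e` has to be shorter than the name.
    exfalso
    have hne : y ≠ z := by
      rintro rfl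
      rw [lcp_self] at hl
      exact absurd hey.le hl.not_ge
    have := lt_nameLen (lcp_mem_internals hy hz hs hne) (lcp_begins_left.of_le hey hl.le) hl
    exact absurd hn.le this.not_ge

/-- `lo` and `hi` are the smallest and the largest element of `S` that begins with `q`. -/
structure IsRange (w : ℕ) (S : Finset ℕ) (q : BStr) (lo hi : ℕ) : Prop where
  lo_mem : lo ∈ S
  hi_mem : hi ∈ S
  begins_lo : Begins q (w, lo)
  begins_hi : Begins q (w, hi)
  lo_le : ∀ z ∈ S, Begins q (w, z) → lo ≤ z
  le_hi : ∀ z ∈ S, Begins q (w, z) → z ≤ hi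

theorem exists_isRange {q : BStr} (h : ∃ y ∈ S, Begins q (w, y)) :
    ∃ lo hi, IsRange w S q lo hi := by
  have hne : (S.filter fun y => Begins q (w, y)).Nonempty := by
    obtain ⟨y, hy⟩ := h
    exact ⟨y, by simpa using hy⟩
  obtain ⟨lo, hlo, h1⟩ := Finset.exists_min_image _ id hne
  obtain ⟨hi, hhi, h2⟩ := Finset.exists_max_image _ id hne
  simp only [Finset.mem_filter, id, and_imp] at *
  exact ⟨lo, hi, hlo.1, hhi.1, hlo.2, hhi.2, h1, h2⟩

theorem IsRange.lcp_eq (hw : ∀ y ∈ S, y < 2 ^ w) {e : BStr} (he : e ∈ nodes w S) {lo hi : ℕ}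
    (h : IsRange w S e lo hi) : lcp w lo hi = e := by
  have hs : Nat.size (lo ^^^ hi) ≤ w := size_xor_le (hw _ h.lo_mem) (hw _ h.hi_mem)
  refine (((begins_lcp hs).2 ⟨h.begins_lo, h.begins_hi⟩).eq_of_length ?_).symm
  rcases mem_nodes.1 he with hi' | ⟨y, hy, rfl⟩
  · obtain ⟨⟨y, hy, hby⟩, z, hz, hbz⟩ := mem_internals.1 hi'
    have hey := begins_pair hby (v := e.2) (by omega)
    have hez := begins_pair hbz (v := e.2) (by omega)
    have hall : ∀ u ∈ S, Begins e (w, u) → Begins (lcp w lo hi) (w, u) := fun u hu heu =>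
      begins_of_mem_Icc lcp_begins_left (lcp_begins_right hs) (h.lo_le u hu heu) (h.le_hi u hu heu)
    exact length_le_of_begins_branches hby hbz (hall y hy hey) (hall z hz hez)
  · simp [lcp, take]

/-- Every string that begins an element of `S` lies between the name and the extent of a node. -/
theorem exists_locus (hw : ∀ y ∈ S, y < 2 ^ w) {q : BStr} (h : ∃ y ∈ S, Begins q (w, y)) :
    ∃ e ∈ nodes w S, Begins q e ∧ nameLen w S e ≤ q.1 ∧
      ∀ z ∈ S, Begins q (w, z) → Begins e (w, z) := by
  obtain ⟨lo, hi, hr⟩ := exists_isRange h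
  have hs : Nat.size (lo ^^^ hi) ≤ w := size_xor_le (hw _ hr.lo_mem) (hw _ hr.hi_mem)
  have hall : ∀ z ∈ S, Begins q (w, z) → Begins (lcp w lo hi) (w, z) := fun z hz hqz =>
    begins_of_mem_Icc lcp_begins_left (lcp_begins_right hs) (hr.lo_le z hz hqz) (hr.le_hi z hz hqz)
  have hq : Begins q (lcp w lo hi) := (begins_lcp hs).2 ⟨hr.begins_lo, hr.begins_hi⟩
  refine ⟨lcp w lo hi, ?_, hq, ?_, hall⟩
  · by_cases hne : lo = hi
    · subst hne
      rw [lcp_self]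
      exact mem_nodes.2 (.inr ⟨lo, hr.lo_mem, rfl⟩)
    · exact mem_nodes.2 (.inl (lcp_mem_internals hr.lo_mem hr.hi_mem hs hne))
  · -- An ancestor of length at least `|q|` would branch within the elements that begin with `q`.
    refine nameLen_le_iff.2 fun p hp hpe hne => ?_
    by_contra! hlt
    obtain ⟨⟨y, hy, hby⟩, z, hz, hbz⟩ := mem_internals.1 hp
    have hqp : Begins q p := hq.of_le hpe hlt
    have := length_le_of_begins_branches hby hbz
      (hall y hy (hqp.trans (begins_pair hby (by omega))))
      (hall z hz (hqp.trans (begins_pair hbz (by omega))))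
    exact hne (hpe.eq_of_length this)

theorem Begins.name_begins {e q : BStr} (h : Begins q e) (hl : nameLen w S e ≤ q.1) :
    Begins (name w S e) q :=
  (LongDist.name_begins e).of_le h hl

/-- A string lies between the name and the extent of at most one node. -/
theorem node_unique (hw : ∀ y ∈ S, y < 2 ^ w) {e e' q : BStr} (he : e ∈ nodes w S)
    (he' : e' ∈ nodes w S) (hq : Begins q e) (hq' : Begins q e') (hl : nameLen w S e ≤ q.1)
    (hl' : nameLen w S e' ≤ q.1) : e = e' := by
  have key : ∀ {e : BStr}, e ∈ nodes w S → Begins q e → nameLen w S e ≤ q.1 → ∀ {lo hi : ℕ},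
      IsRange w S q lo hi → IsRange w S e lo hi := fun {e} he hq hl {lo hi} h =>
    have hn : ∀ z ∈ S, Begins q (w, z) → Begins e (w, z) := fun z hz hqz =>
      begins_of_name_begins hw he hz ((hq.name_begins hl).trans hqz)
    ⟨h.lo_mem, h.hi_mem, hn _ h.lo_mem h.begins_lo, hn _ h.hi_mem h.begins_hi,
      fun z hz hz' => h.lo_le z hz (hq.trans hz'), fun z hz hz' => h.le_hi z hz (hq.trans hz')⟩
  obtain ⟨y, hy, hey⟩ := exists_begins_of_mem_nodes he
  obtain ⟨lo, hi, hr⟩ := exists_isRange ⟨y, hy, hq.trans hey⟩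
  rw [← (key he hq hl hr).lcp_eq hw he, ← (key he' hq' hl' hr).lcp_eq hw he']

theorem mem_internals_of_length_lt {e : BStr} (he : e ∈ nodes w S) (h : e.1 < w) :
    e ∈ internals w S := by
  rcases mem_nodes.1 he with h' | ⟨y, -, rfl⟩
  · exact h'
  · exact absurd h (lt_irrefl _)

theorem mem_nodes_of_mem_internals {e : BStr} (he : e ∈ internals w S) : e ∈ nodes w S :=
  mem_nodes.2 (.inl he)

end

/-! ### The range locator -/

section
variable {w : ℕ} {S : Finset ℕ} {F : Table → BStr → ℕ}

theorem mem_ends_left {d : ℕ} :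
    d ∈ ends w S false ↔ ∃ e ∈ nodes w S, (name w S e).2 * 2 ^ (w - (name w S e).1) = d := by
  simp only [ends, Finset.mem_image, exists_exists_and_eq_and]

theorem mem_ends_right {d : ℕ} : d ∈ ends w S true ↔
    ∃ e ∈ nodes w S, ((name w S e).2 + 1) * 2 ^ (w - (name w S e).1) - 1 = d := by
  simp only [ends, Finset.mem_image, exists_exists_and_eq_and]

theorem name_lt (hw : ∀ y ∈ S, y < 2 ^ w) {e : BStr} (he : e ∈ nodes w S) :
    (name w S e).1 ≤ w ∧ ((name w S e).2 + 1) * 2 ^ (w - (name w S e).1) ≤ 2 ^ w := by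
  obtain ⟨y, hy, h⟩ := exists_begins_of_mem_nodes he
  have h' := begins_iff.1 ((name_begins (w := w) (S := S) e).trans h)
  refine ⟨h'.1, ?_⟩
  have hlt : (name w S e).2 < 2 ^ (name w S e).1 := by
    rw [← h'.2, Nat.div_lt_iff_lt_mul (by positivity), ← pow_add]
    have hle := h'.1
    simp only at hle ⊢
    rw [show (name w S e).1 + (w - (name w S e).1) = w by omega]
    exact hw y hy
  calc _ ≤ 2 ^ (name w S e).1 * 2 ^ (w - (name w S e).1) := Nat.mul_le_mul_right _ hlt
    _ = 2 ^ w := by rw [← pow_add]; congr 1; have := h'.1; simp only at this; omega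

theorem ends_lt (hw : ∀ y ∈ S, y < 2 ^ w) {right : Bool} {d : ℕ} (hd : d ∈ ends w S right) :
    d < 2 ^ w := by
  cases right
  · obtain ⟨e, he, rfl⟩ := mem_ends_left.1 hd
    refine lt_of_lt_of_le ?_ (name_lt hw he).2
    rw [Nat.add_mul]
    have : 0 < 2 ^ (w - (name w S e).1) := by positivity
    omega
  · obtain ⟨e, he, rfl⟩ := mem_ends_right.1 hd
    have h1 := (name_lt hw he).2
    have : 0 < ((name w S e).2 + 1) * 2 ^ (w - (name w S e).1) := by positivity
    omega

theorem rank_mono (right : Bool) {d d' : ℕ} (h : d ≤ d') : rank S right d ≤ rank S right d' := by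
  cases right
  · exact Finset.card_le_card (Finset.monotone_filter_right _ fun y _ hy => lt_of_lt_of_le hy h)
  · exact Nat.sub_le_sub_right
      (Finset.card_le_card (Finset.monotone_filter_right _ fun y _ hy => le_trans hy h)) 1

theorem mem_bucket_self {right : Bool} {d : ℕ} (hd : d ∈ ends w S right) :
    d ∈ bucket w S right d := Finset.mem_filter.2 ⟨hd, rfl⟩

theorem bucketNo_mono (right : Bool) {d d' : ℕ} (h : d ≤ d') :
    bucketNo w S right d ≤ bucketNo w S right d' :=
  Nat.div_le_div_right
    (Finset.card_le_card (Finset.monotone_filter_right _ fun _ _ hy => lt_of_lt_of_le hy h))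

theorem bucketBase_le_rank {right : Bool} {d : ℕ} (hd : d ∈ ends w S right) :
    bucketBase w S right d ≤ rank S right d := by
  refine rank_mono right ?_
  obtain ⟨m, hm⟩ := Finset.min_of_mem (mem_bucket_self hd)
  rw [hm]
  exact Finset.min_le_of_eq (mem_bucket_self hd) hm

theorem bucketLcp_le (right : Bool) (d : ℕ) : bucketLcp w S right d ≤ w := Nat.findGreatest_le _

theorem take_bucketLcp (hw : ∀ y ∈ S, y < 2 ^ w) {right : Bool} {d d' : ℕ}
    (hd : d ∈ ends w S right) (hd' : d' ∈ bucket w S right d) :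
    take (w, d') (bucketLcp w S right d) = take (w, d) (bucketLcp w S right d) := by
  refine Nat.findGreatest_spec
    (P := fun l => ∀ d' ∈ bucket w S right d, take (w, d') l = take (w, d) l)
    (Nat.zero_le w) ?_ d' hd'
  intro u hu
  simp only [take, Nat.sub_zero]
  rw [Nat.div_eq_of_lt (ends_lt hw (Finset.mem_filter.1 hu).1), Nat.div_eq_of_lt (ends_lt hw hd)]

/-- A bucket whose longest common prefix is not a complete string branches there. -/
theorem exists_branches_bucket (hw : ∀ y ∈ S, y < 2 ^ w) {right : Bool} {d : ℕ}
    (hd : d ∈ ends w S right) (hl : bucketLcp w S right d < w) (b : ℕ) (hb : b < 2) :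
    ∃ u ∈ bucket w S right d, u / 2 ^ (w - (bucketLcp w S right d + 1)) =
      2 * (d / 2 ^ (w - bucketLcp w S right d)) + b := by
  have hnot := Nat.findGreatest_is_greatest (lt_add_one (bucketLcp w S right d)) hl
  push Not at hnot
  obtain ⟨u, hu, hne⟩ := hnot
  have h := congrArg Prod.snd (take_bucketLcp hw hd hu)
  simp only [take, ne_eq, Prod.mk.injEq, true_and] at h hne
  have e : ∀ v : ℕ, v / 2 ^ (w - bucketLcp w S right d) =
      v / 2 ^ (w - (bucketLcp w S right d + 1)) / 2 := by
    intro v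
    rw [Nat.div_div_eq_div_mul, ← pow_succ]
    congr 2
    omega
  rw [e, e] at h
  rw [e]
  by_cases hd' : d / 2 ^ (w - (bucketLcp w S right d + 1)) % 2 = b
  · exact ⟨d, mem_bucket_self hd, by omega⟩
  · exact ⟨u, hu, by omega⟩

/-- Distinct buckets have distinct longest common prefixes. -/
theorem bucketNo_eq_of_take_eq (hw : ∀ y ∈ S, y < 2 ^ w) {right : Bool} {d d' : ℕ}
    (hd : d ∈ ends w S right) (hd' : d' ∈ ends w S right)
    (h : take (w, d) (bucketLcp w S right d) = take (w, d') (bucketLcp w S right d')) :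
    bucketNo w S right d = bucketNo w S right d' := by
  wlog hlt : bucketNo w S right d < bucketNo w S right d' generalizing d d'
  · rcases (not_lt.1 hlt).eq_or_lt with h' | h'
    · exact h'.symm
    · exact (this hd' hd h.symm h').symm
  have hll : bucketLcp w S right d = bucketLcp w S right d' := congrArg Prod.fst h
  have hv : d / 2 ^ (w - bucketLcp w S right d) = d' / 2 ^ (w - bucketLcp w S right d') :=
    congrArg Prod.snd h
  rcases (bucketLcp_le (w := w) (S := S) right d).eq_or_lt with hl | hl
  · rw [← hll, hl] at hv
    simp only [Nat.sub_self, pow_zero, Nat.div_one] at hv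
    rw [hv]
  · -- The right branch in the lower bucket contradicts the left branch in the upper one.
    obtain ⟨u, hu, h1⟩ := exists_branches_bucket hw hd hl 1 (by omega)
    obtain ⟨u', hu', h0⟩ := exists_branches_bucket hw hd' (hll ▸ hl) 0 (by omega)
    exfalso
    have hle : u' ≤ u := by
      by_contra! hlt'
      have := Nat.div_le_div_right (c := 2 ^ (w - (bucketLcp w S right d + 1))) hlt'.le
      rw [h1, hv, hll, h0] at this
      omega
    have := bucketNo_mono (w := w) (S := S) right hle
    rw [(Finset.mem_filter.1 hu).2, (Finset.mem_filter.1 hu').2] at this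
    exact absurd hlt this.not_gt

theorem value_baseMap (hw : ∀ y ∈ S, y < 2 ^ w) {right : Bool} {d : ℕ}
    (hd : d ∈ ends w S right) :
    value w S (.baseMap right) (take (w, d) (bucketLcp w S right d)) = bucketBase w S right d := by
  simp only [value]
  refine le_antisymm (Finset.sup_le fun d' hd' => ?_) ?_
  · obtain ⟨hd', h⟩ := Finset.mem_filter.1 hd'
    have := bucketNo_eq_of_take_eq hw hd' hd h
    simp only [bucketBase, bucket, this, le_refl]
  · exact Finset.le_sup (f := bucketBase w S right) (Finset.mem_filter.2 ⟨hd, rfl⟩)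

theorem card_le (hw : ∀ y ∈ S, y < 2 ^ w) : S.card ≤ 2 ^ w := by
  have : S ⊆ Finset.range (2 ^ w) := fun y hy => Finset.mem_range.2 (hw y hy)
  simpa using Finset.card_le_card this

theorem rankVal_eq (hw : ∀ y ∈ S, y < 2 ^ w) (hF : Stores w S F) {right : Bool} {d : ℕ}
    (hd : d ∈ ends w S right) (hr : rank S right d < S.card) :
    rankVal w S F right d = rank S right d := by
  have hl : F (.lcpMap right) (w, d) = bucketLcp w S right d :=
    (hF (.lcpMap right)).2 _ (Finset.mem_image_of_mem _ hd)
  have ho : F (.offsetMap right) (w, d) = rank S right d - bucketBase w S right d :=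
    (hF (.offsetMap right)).2 _ (Finset.mem_image_of_mem _ hd)
  have hb : F (.baseMap right) (take (w, d) (bucketLcp w S right d)) = bucketBase w S right d := by
    rw [(hF (.baseMap right)).2 _ (Finset.mem_image_of_mem _ hd), value_baseMap hw hd]
  have hle := bucketBase_le_rank hd
  have hc := card_le hw
  simp only [take] at hb
  rw [rankVal, hl, ho, takeVal_eq le_rfl (bucketLcp_le _ _), hb, Nat.add_sub_cancel' hle,
    Nat.mod_eq_of_lt (by omega)]
  omega

theorem begins_iff_mem_Ico {p : BStr} {z : ℕ} (hp : p.1 ≤ w) :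
    Begins p (w, z) ↔ p.2 * 2 ^ (w - p.1) ≤ z ∧ z < (p.2 + 1) * 2 ^ (w - p.1) := by
  rw [begins_iff]
  simp only [hp, true_and]
  rw [Nat.div_eq_iff (by positivity), Nat.add_mul, one_mul]
  have : 0 < 2 ^ (w - p.1) := by positivity
  omega

theorem leftVal_name (hw : ∀ y ∈ S, y < 2 ^ w) (hF : Stores w S F) {e : BStr}
    (he : e ∈ nodes w S) {lo hi : ℕ} (h : IsRange w S (name w S e) lo hi) :
    leftVal w S F (name w S e) = (S.filter (· < lo)).card := by
  have hp := (name_lt hw he).1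
  have hd : (name w S e).2 * 2 ^ (w - (name w S e).1) ∈ ends w S false :=
    mem_ends_left.2 ⟨e, he, rfl⟩
  have hrank : rank S false ((name w S e).2 * 2 ^ (w - (name w S e).1)) =
      (S.filter (· < lo)).card := by
    simp only [rank]
    congr 1
    refine Finset.filter_congr fun z hz => ?_
    have h1 := (begins_iff_mem_Ico hp).1 h.begins_lo
    have h2 := h.lo_le z hz
    rw [begins_iff_mem_Ico hp] at h2
    omega
  rw [leftVal, sub_mod_word w.lt_two_pow_self hp, Nat.mod_eq_of_lt (ends_lt hw hd),
    rankVal_eq hw hF hd (hrank ▸ card_filter_lt_lt h.lo_mem), hrank]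

theorem rightVal_name (hw : ∀ y ∈ S, y < 2 ^ w) (hF : Stores w S F) {e : BStr}
    (he : e ∈ nodes w S) {lo hi : ℕ} (h : IsRange w S (name w S e) lo hi) :
    rightVal w S F (name w S e) = (S.filter (· < hi)).card := by
  obtain ⟨hp, hp2⟩ := name_lt hw he
  have hd : ((name w S e).2 + 1) * 2 ^ (w - (name w S e).1) - 1 ∈ ends w S true :=
    mem_ends_right.2 ⟨e, he, rfl⟩
  have hlt := ends_lt hw hd
  have hrank : rank S true (((name w S e).2 + 1) * 2 ^ (w - (name w S e).1) - 1) =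
      (S.filter (· < hi)).card := by
    have : S.filter (· ≤ ((name w S e).2 + 1) * 2 ^ (w - (name w S e).1) - 1) =
        insert hi (S.filter (· < hi)) := by
      ext z
      simp only [Finset.mem_filter, Finset.mem_insert]
      have h1 := (begins_iff_mem_Ico hp).1 h.begins_hi
      have h2 := h.le_hi z
      rw [begins_iff_mem_Ico hp] at h2
      have h3 := h.hi_mem
      constructor
      · rintro ⟨hz, hz'⟩
        have := h2 hz
        by_cases hzz : z = hi
        · exact .inl hzz
        · exact .inr ⟨hz, by omega⟩
      · rintro (rfl | ⟨hz, hz'⟩)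
        · exact ⟨h3, by omega⟩
        · exact ⟨hz, by omega⟩
    simp only [rank, this]
    rw [Finset.card_insert_of_notMem (by simp), Nat.add_sub_cancel]
  have hpos : 0 < 2 ^ (w - (name w S e).1) := by positivity
  have hmul : ((name w S e).2 + 1) * 2 ^ (w - (name w S e).1) =
    (name w S e).2 * 2 ^ (w - (name w S e).1) + 2 ^ (w - (name w S e).1) := by ring
  have hones : (1 * 2 ^ (w - (name w S e).1) % 2 ^ w + 2 ^ w - 1) % 2 ^ w =
      2 ^ (w - (name w S e).1) - 1 := by
    rw [one_mul]
    -- For the empty name, the shifted one is lost, and the subtraction wraps around.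
    rcases (Nat.pow_le_pow_right two_pos (Nat.sub_le w (name w S e).1)).eq_or_lt with h1 | h1
    · rw [h1, Nat.mod_self, Nat.mod_eq_of_lt] <;> omega
    · rw [Nat.mod_eq_of_lt h1, sub_mod_word h1 hpos]
  rw [rightVal, sub_mod_word w.lt_two_pow_self hp, hones,
    Nat.mod_eq_of_lt (a := (name w S e).2 * 2 ^ (w - (name w S e).1)) (by omega),
    show (name w S e).2 * 2 ^ (w - (name w S e).1) + (2 ^ (w - (name w S e).1) - 1) =
      ((name w S e).2 + 1) * 2 ^ (w - (name w S e).1) - 1 by omega, Nat.mod_eq_of_lt hlt,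
    rankVal_eq hw hF hd (hrank ▸ card_filter_lt_lt h.hi_mem), hrank]

theorem IsRange.of_name (hw : ∀ y ∈ S, y < 2 ^ w) {e q : BStr} (he : e ∈ nodes w S)
    (hq : Begins q e) (hl : nameLen w S e ≤ q.1) {lo hi : ℕ} (h : IsRange w S e lo hi) :
    IsRange w S q lo hi :=
  have hn : ∀ z ∈ S, Begins q (w, z) → Begins e (w, z) := fun _ hz hqz =>
    begins_of_name_begins hw he hz ((hq.name_begins hl).trans hqz)
  ⟨h.lo_mem, h.hi_mem, hq.trans h.begins_lo, hq.trans h.begins_hi,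
    fun z hz hz' => h.lo_le z hz (hn z hz hz'), fun z hz hz' => h.le_hi z hz (hn z hz hz')⟩

/-- The range locator is correct at the names of nodes. -/
theorem nth_name (hw : ∀ y ∈ S, y < 2 ^ w) (hF : Stores w S F) {e : BStr}
    (he : e ∈ nodes w S) {lo hi : ℕ} (h : IsRange w S e lo hi) :
    nth S (leftVal w S F (name w S e)) = lo ∧ nth S (rightVal w S F (name w S e)) = hi ∧
      extentVal w S F (name w S e) = e := by
  have h' := h.of_name hw he (name_begins e) le_rfl
  have hl : nth S (leftVal w S F (name w S e)) = lo := by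
    rw [leftVal_name hw hF he h', nth_card_filter_lt h.lo_mem]
  have hr : nth S (rightVal w S F (name w S e)) = hi := by
    rw [rightVal_name hw hF he h', nth_card_filter_lt h.hi_mem]
  exact ⟨hl, hr, by rw [extentVal, hl, hr, h.lcp_eq hw he]⟩

theorem extentVal_name (hw : ∀ y ∈ S, y < 2 ^ w) (hF : Stores w S F) {e : BStr}
    (he : e ∈ nodes w S) : extentVal w S F (name w S e) = e := by
  obtain ⟨lo, hi, h⟩ := exists_isRange (exists_begins_of_mem_nodes he)
  exact (nth_name hw hF he h).2.2

/-! ### Handles and cuts -/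

theorem twoFattest_eq {I : Finset ℕ} {f : ℕ} (hf : f ∈ I)
    (h : ∀ g ∈ I, g ≠ f → padicValNat 2 g < padicValNat 2 f) : twoFattest I = f := by
  have : I.filter (fun f => ∀ g ∈ I, padicValNat 2 g ≤ padicValNat 2 f) = {f} := by
    ext g
    simp only [Finset.mem_filter, Finset.mem_singleton]
    constructor
    · rintro ⟨hg, hg'⟩
      by_contra hne
      exact absurd (h g hg hne) (hg' f hf).not_gt
    · rintro rfl
      refine ⟨hf, fun g' hg' => ?_⟩
      by_cases hne : g' = g
      · rw [hne]
      · exact (h g' hg' hne).le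
  rw [twoFattest, this, Finset.sup_singleton, id]

theorem twoFattest_mem {I : Finset ℕ} (h : twoFattest I ≠ 0) : twoFattest I ∈ I := by
  have hne : (I.filter fun f => ∀ g ∈ I, padicValNat 2 g ≤ padicValNat 2 f).Nonempty := by
    by_contra hemp
    rw [Finset.not_nonempty_iff_eq_empty] at hemp
    exact h (by rw [twoFattest, hemp]; rfl)
  obtain ⟨f, hf, hf'⟩ := Finset.exists_mem_eq_sup _ hne id
  rw [twoFattest, hf']
  exact (Finset.mem_filter.1 hf).1

theorem handleMap_eq (hw : ∀ y ∈ S, y < 2 ^ w) (hF : Stores w S F) {e : BStr}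
    (he : e ∈ internals w S) (h0 : twoFattest (skip w S e) ≠ 0) :
    F .handleMap (handle w S e) = nameLen w S e := by
  rw [(hF .handleMap).2 _ (Finset.mem_image_of_mem _ he)]
  have : (internals w S).filter (fun e' => handle w S e' = handle w S e) = {e} := by
    ext e'
    simp only [Finset.mem_filter, Finset.mem_singleton]
    constructor
    · rintro ⟨he', heq⟩
      have hlen : twoFattest (skip w S e') = twoFattest (skip w S e) := congrArg Prod.fst heq
      have h1 := Finset.mem_Icc.1 (twoFattest_mem h0)
      have h2 := Finset.mem_Icc.1 (twoFattest_mem (hlen ▸ h0 : twoFattest (skip w S e') ≠ 0))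
      exact node_unique hw (mem_nodes_of_mem_internals he') (mem_nodes_of_mem_internals he)
        (q := handle w S e) (heq ▸ take_begins h2.2) (take_begins h1.2)
        (by rw [← heq]; exact (le_max_right _ _).trans h2.1) ((le_max_right _ _).trans h1.1)
    · rintro rfl
      exact ⟨he, rfl⟩
  simp only [value]
  rw [this, Finset.sup_singleton]

theorem exitNodes_eq (hw : ∀ y ∈ S, y < 2 ^ w) {e p : BStr} (he : e ∈ nodes w S)
    (hp : Begins p e) (hl : nameLen w S e ≤ p.1) : exitNodes w S p = {e} := by
  ext e'
  simp only [exitNodes, Finset.mem_filter, Finset.mem_singleton]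
  constructor
  · rintro ⟨he', hn, h⟩
    have hpe' : Begins p e' := by
      rcases h with rfl | h
      · exact Begins.refl _
      · obtain ⟨z, hz, hez⟩ := exists_begins_of_mem_nodes he
        have hez' := begins_of_name_begins hw he' hz (hn.trans (hp.trans hez))
        rcases le_total e'.1 p.1 with hle | hle
        · exact absurd (hez'.of_le (hp.trans hez) hle) h
        · exact (hp.trans hez).of_le hez' hle
    exact node_unique hw he' he hpe' hp hn.le hl
  · rintro rfl
    refine ⟨he, hp.name_begins hl, ?_⟩
    by_cases h : Begins e' p
    · exact .inl (h.eq_of_length hp.le)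
    · exact .inr h

theorem cutMap_eq (hw : ∀ y ∈ S, y < 2 ^ w) (hF : Stores w S F) {e : BStr}
    (he : e ∈ internals w S) {k : ℕ} (hk : 2 ^ k ∈ skip w S e)
    (hmin : ∀ j, 2 ^ j ∈ skip w S e → 2 ^ k ≤ 2 ^ j) :
    F .cutMap (take e (2 ^ k)) = nameLen w S e := by
  have hk' := Finset.mem_Icc.1 hk
  have hmem : take e (2 ^ k) ∈ cuts w S := by
    refine Finset.mem_biUnion.2
      ⟨e, he, Finset.mem_image_of_mem _ (Finset.mem_filter.2 ⟨hk, ?_, ?_⟩)⟩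
    · have := length_lt_of_mem_internals he
      have := k.lt_two_pow_self
      exact ⟨k, Finset.mem_range.2 (by omega), rfl⟩
    · exact fun j _ hj => hmin j hj
  rw [(hF .cutMap).2 _ hmem]
  simp only [value]
  rw [exitNodes_eq hw (mem_nodes_of_mem_internals he) (take_begins hk'.2)
    ((le_max_right _ _).trans hk'.1), Finset.sup_singleton]

end

section
variable {w : ℕ} {S : Finset ℕ} {F : Table → BStr → ℕ}

/-! ### Fat binary search -/

/-- The prefix of length `l` of `x` is a branching string: the extent of an internal node above
`x`. -/
def Anc (w : ℕ) (S : Finset ℕ) (x l : ℕ) : Prop := take (w, x) l ∈ internals w S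

theorem Anc.lt {x l : ℕ} (h : Anc w S x l) : l < w := length_lt_of_mem_internals h

theorem anc_of_begins {e : BStr} {x : ℕ} (he : e ∈ internals w S) (h : Begins e (w, x)) :
    Anc w S x e.1 := by
  rw [Anc, h.take_eq]
  exact he

/-- If a branching prefix of `x` has length at least `f`, then `f` belongs to the skip interval of
some internal node above `x`.  This interval lies above every `a < f` that is the length of a
branching prefix. -/
theorem exists_skip_of_anc (hw : ∀ y ∈ S, y < 2 ^ w) {x a f l : ℕ} (ha : a = 0 ∨ Anc w S x a)
    (haf : a < f) (hl : Anc w S x l) (hfl : f ≤ l) :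
    ∃ e ∈ internals w S, Begins e (w, x) ∧ e.1 ≤ l ∧ f ∈ skip w S e ∧ ∀ g ∈ skip w S e, a < g := by
  have hlw := hl.lt
  obtain ⟨⟨y, hy, hby⟩, z, hz, hbz⟩ := mem_internals.1 hl
  have hly : Begins (take (w, x) l) (w, y) := begins_pair hby (by simp only [take]; omega)
  have hlz : Begins (take (w, x) l) (w, z) := begins_pair hbz (by simp only [take]; omega)
  have hfl' : Begins (take (w, x) f) (take (w, x) l) :=
    (take_begins (by simp only; omega)).of_le (take_begins hlw.le) hfl
  obtain ⟨e, he, hfe, hne, hall⟩ := exists_locus (q := take (w, x) f) hw ⟨y, hy, hfl'.trans hly⟩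
  have hel : e.1 ≤ l := length_le_of_begins_branches hby hbz (hall y hy (hfl'.trans hly))
    (hall z hz (hfl'.trans hlz))
  have hex : Begins e (w, x) :=
    ((hall y hy (hfl'.trans hly)).of_le hly hel).trans (take_begins hlw.le)
  have hfe' : f ≤ e.1 := hfe.le
  refine ⟨e, mem_internals_of_length_lt he (by omega), hex, hel,
    Finset.mem_Icc.2 ⟨max_le (by omega) hne, hfe'⟩, fun g hg => ?_⟩
  have hg1 := (Finset.mem_Icc.1 hg).1
  rcases ha with rfl | ha
  · omega
  · have := lt_nameLen (e := e) ha ((take_begins ha.lt.le).of_le hex (show a ≤ e.1 by omega))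
      (show a < e.1 by omega)
    simp only [take] at this
    omega

theorem pair_takeVal {p q : BStr} (h : Begins p q) (hq : q.1 ≤ w) :
    (p.1, takeVal w q.1 q.2 p.1) = p := by
  rw [takeVal_eq hq h.le]
  exact h.take_eq

theorem extentVal_mem_internals (hS : S.Nonempty) (hw : ∀ y ∈ S, y < 2 ^ w) {p : BStr}
    (h : (extentVal w S F p).1 < w) : extentVal w S F p ∈ internals w S := by
  have h1 := nth_leftVal_mem (w := w) (F := F) hS p
  have h2 := nth_rightVal_mem (w := w) (F := F) hS p
  refine lcp_mem_internals h1 h2 (size_xor_le (hw _ h1) (hw _ h2)) fun heq => ?_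
  rw [extentVal, heq, lcp_self] at h
  exact lt_irrefl _ h

/-- The string computed by `zfastP`, which is the extent of an internal node if `h` is its handle
and not empty. -/
def zfastVal (w : ℕ) (S : Finset ℕ) (F : Table → BStr → ℕ) (h : BStr) : BStr :=
  extentVal w S F (F .handleMap h, takeVal w h.1 h.2 (F .handleMap h))

/-- A negative test of fat binary search is right: if some branching prefix of `x` had length at
least `f`, then `x[0..f)` would be a handle, and the test would be positive. -/
theorem lt_fattest_of_anc (hw : ∀ y ∈ S, y < 2 ^ w) (hF : Stores w S F) {x a b f k : ℕ}
    (ha : a = 0 ∨ Anc w S x a) (hb : ∀ l, Anc w S x l → l < b) (haf : a < f) (hkf : 2 ^ k ∣ f)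
    (hf : ∀ g, a < g → g < b → 2 ^ k ∣ g → g = f)
    (hno : ¬ (f ≤ (zfastVal w S F (take (w, x) f)).1 ∧ (zfastVal w S F (take (w, x) f)).1 < w ∧
      Begins (zfastVal w S F (take (w, x) f)) (w, x))) :
    ∀ l, Anc w S x l → l < f := by
  intro l hl
  by_contra! hfl
  obtain ⟨e, he, hex, hel, hfs, hsk⟩ := exists_skip_of_anc hw ha haf hl hfl
  have hlb := hb l hl
  have hfs' := Finset.mem_Icc.1 hfs
  have htf : twoFattest (skip w S e) = f := by
    refine twoFattest_eq hfs fun g hg hgf => ?_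
    have hg' := Finset.mem_Icc.1 hg
    have hnd : ¬ 2 ^ k ∣ g := fun hd => hgf (hf g (hsk g hg) (by omega) hd)
    rw [padicValNat_dvd_iff_le (by omega)] at hnd
    rw [padicValNat_dvd_iff_le (by omega)] at hkf
    omega
  have hh : handle w S e = take (w, x) f := by
    rw [handle, htf]
    exact ((((take_begins hfs'.2).trans hex).take_eq).symm)
  have hz : zfastVal w S F (take (w, x) f) = e := by
    have hbn : Begins (name w S e) (take (w, x) f) :=
      Begins.name_begins (hh ▸ take_begins (htf ▸ hfs'.2)) ((le_max_right _ _).trans hfs'.1)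
    have hfw : f ≤ w := hfs'.2.trans hex.le
    rw [zfastVal, ← hh, handleMap_eq hw hF he (by omega), hh]
    have := pair_takeVal hbn hfw
    rw [show nameLen w S e = (name w S e).1 from rfl, this]
    exact extentVal_name hw hF (mem_nodes_of_mem_internals he)
  rw [hz] at hno
  exact hno ⟨hfs'.2, length_lt_of_mem_internals he, hex⟩

/-- The program finds the only multiple of `2 ^ k` in the interval `(a..b)`, where `k` is the
highest bit in which `a` and `b - 1` differ. -/
theorem runs_fattestP {a b : ℕ} (hab : 1 < b - a) (hb : b < 2 ^ w) :
    Runs w S F (fattestP a b) 6 fun f => ∃ k, a < f ∧ f < b ∧ 2 ^ k ∣ f ∧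
      (∀ g, a < g → g < b → 2 ^ k ∣ g → g = f) ∧ a / 2 ^ k ≠ (b - 1) / 2 ^ k ∧
      a / 2 ^ k = (f - 1) / 2 ^ k ∧ f / 2 ^ k = (b - 1) / 2 ^ k := by
  refine Runs.exec_bind (Runs.exec_bind (Runs.exec_bind (Runs.exec_bind (Runs.exec_bind
    ((Runs.exec _).mono le_rfl ?_)))))
  rintro _ rfl
  simp only [Instr.result]
  rw [sub_mod_word hb (by omega)]
  have hpos : 0 < Nat.size (a ^^^ (b - 1)) := by
    rw [Nat.size_pos, Nat.pos_iff_ne_zero, Ne, Nat.xor_eq_zero_iff]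
    omega
  have hsw := size_xor_le (show a < 2 ^ w by omega) (show b - 1 < 2 ^ w by omega)
  have h2w := w.lt_two_pow_self
  rw [sub_mod_word (l := Nat.size (a ^^^ (b - 1))) (m := 1) (hsw.trans_lt h2w) hpos]
  obtain ⟨k, hk⟩ : ∃ k, Nat.size (a ^^^ (b - 1)) = k + 1 :=
    ⟨Nat.size (a ^^^ (b - 1)) - 1, by omega⟩
  rw [hk, Nat.add_sub_cancel]
  have h1 : a / 2 ^ (k + 1) = (b - 1) / 2 ^ (k + 1) := div_two_pow_eq_iff.2 (by omega)
  have h2 : ¬ a / 2 ^ k = (b - 1) / 2 ^ k := by rw [div_two_pow_eq_iff]; omega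
  have h3 : a / 2 ^ k ≤ (b - 1) / 2 ^ k := Nat.div_le_div_right (by omega)
  rw [pow_succ, ← Nat.div_div_eq_div_mul, ← Nat.div_div_eq_div_mul] at h1
  have h4 : (b - 1) / 2 ^ k = a / 2 ^ k + 1 := by omega
  have hp : 0 < 2 ^ k := by positivity
  have hle : (b - 1) / 2 ^ k * 2 ^ k ≤ b - 1 := Nat.div_mul_le_self _ _
  rw [Nat.mod_eq_of_lt (by omega)]
  refine ⟨k, ?_, by omega, Dvd.intro_left _ rfl, ?_, h2, ?_, Nat.mul_div_cancel _ hp⟩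
  · rw [← Nat.div_lt_iff_lt_mul hp]; omega
  · rintro g hag hgb ⟨c, rfl⟩
    have h5 : a / 2 ^ k < c := by rw [Nat.div_lt_iff_lt_mul hp, mul_comm]; exact hag
    have h6 : c ≤ (b - 1) / 2 ^ k := by rw [Nat.le_div_iff_mul_le hp, mul_comm]; omega
    rw [show c = (b - 1) / 2 ^ k by omega, mul_comm]
  · rw [h4, eq_comm, Nat.div_eq_iff hp, Nat.add_mul, one_mul]
    omega

/-- The body of the loop of fat binary search. -/
def fbsBody (w n x : ℕ) (s : ℕ × ℕ) : RAM ((ℕ × ℕ) ⊕ ℕ) := do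
  let (a, b) := s
  let d ← exec (.sub b a)
  if ← test (.lt 1 d) then
    let f ← fattestP a b
    let v ← takeP w x f
    let e ← zfastP w n (f, v)
    if ← test (.le f e.1) then
      if ← test (.lt e.1 w) then
        if ← beginsP e (w, x) then return .inl (e.1, b) else return .inl (a, f)
      else return .inl (a, f)
    else return .inl (a, f)
  else return .inr a

/-- One round of fat binary search keeps the invariant, and shortens the part of the two borders
in which they differ. -/
theorem runs_fbsBody (hS : S.Nonempty) (hw : ∀ y ∈ S, y < 2 ^ w) (hF : Stores w S F) {x a b r : ℕ}
    (ha : a = 0 ∨ Anc w S x a) (hb : ∀ l, Anc w S x l → l < b) (hab : a < b) (hbw : b ≤ w)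
    (hr : a / 2 ^ r = (b - 1) / 2 ^ r) :
    Runs w S F (fbsBody w S.card x (a, b)) 47 fun
      | .inl (a', b') => (a' = 0 ∨ Anc w S x a') ∧ (∀ l, Anc w S x l → l < b') ∧ a' < b' ∧ b' ≤ w ∧
          ∃ k < r, a' / 2 ^ k = (b' - 1) / 2 ^ k
      | .inr a' => (a' = 0 ∨ Anc w S x a') ∧ ∀ l, Anc w S x l → l ≤ a' := by
  have hbw' : b < 2 ^ w := hbw.trans_lt w.lt_two_pow_self
  refine Runs.exec_bind (Runs.test_ite (t := 45) rfl (fun hd => ?_) (fun hd => ?_))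
  · rw [Instr.result, sub_mod_word hbw' hab.le] at hd
    refine (runs_fattestP hd hbw').bind (u := 39) ?_
    rintro f ⟨k, haf, hfb, hkf, hf, hne, hk1, hk2⟩
    have hkr : k < r := by
      by_contra! hle
      apply hne
      obtain ⟨j, rfl⟩ := Nat.exists_eq_add_of_le hle
      rw [pow_add, ← Nat.div_div_eq_div_mul, hr, Nat.div_div_eq_div_mul]
    refine (runs_takeP _ _ _).bind (u := 37) ?_
    rintro _ rfl
    rw [takeVal_eq le_rfl (by omega)]
    refine (runs_zfastP hS hw _).bind (u := 6) ?_
    intro e he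
    replace he : e = zfastVal w S F (take (w, x) f) := he
    have hfail : ¬ (f ≤ e.1 ∧ e.1 < w ∧ Begins e (w, x)) →
        (a = 0 ∨ Anc w S x a) ∧ (∀ l, Anc w S x l → l < f) ∧ a < f ∧ f ≤ w ∧
          ∃ k < r, a / 2 ^ k = (f - 1) / 2 ^ k := fun h =>
      ⟨ha, lt_fattest_of_anc hw hF ha hb haf hkf hf (he ▸ h), haf, by omega, k, hkr, hk1⟩
    refine Runs.test_ite (t := 5) rfl (fun h1 => ?_) fun h1 => Runs.pure (hfail fun h => h1 h.1)
    refine Runs.test_ite (t := 4) rfl (fun h2 => ?_) fun h2 => Runs.pure (hfail fun h => h2 h.2.1)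
    refine (runs_beginsP (p := e) (q := (w, x)) le_rfl).bind (u := 0) fun c hc => ?_
    refine Runs.ite_bool hc (fun h3 => ?_) fun h3 => Runs.pure (hfail fun h => h3 h.2.2)
    have hanc : Anc w S x e.1 :=
      anc_of_begins (by rw [he] at h2 ⊢; exact extentVal_mem_internals hS hw h2) h3
    have hlt := hb _ hanc
    refine Runs.pure ⟨.inr hanc, hb, hlt, hbw, k, hkr, le_antisymm ?_ ?_⟩
    · exact Nat.div_le_div_right (by omega)
    · exact hk2 ▸ Nat.div_le_div_right h1
  · rw [Instr.result, sub_mod_word hbw' hab.le] at hd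
    refine Runs.pure ⟨ha, fun l hl => ?_⟩
    have := hb l hl
    omega

/-- The number of rounds of fat binary search is at most one more than the number `r` of low bits
outside which `a` and `b - 1` agree. -/
theorem runs_fbsLoop (hS : S.Nonempty) (hw : ∀ y ∈ S, y < 2 ^ w) (hF : Stores w S F) {x : ℕ}
    (r : ℕ) : ∀ {fuel a b : ℕ}, r < fuel → (a = 0 ∨ Anc w S x a) → (∀ l, Anc w S x l → l < b) →
      a < b → b ≤ w → a / 2 ^ r = (b - 1) / 2 ^ r →
    Runs w S F (loop (fbsBody w S.card x) fuel (a, b)) (47 * (r + 1)) fun a' =>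
      (a' = 0 ∨ Anc w S x a') ∧ ∀ l, Anc w S x l → l ≤ a' := by
  induction r using Nat.strong_induction_on with
  | _ r ih =>
    intro fuel a b hfuel ha hb hab hbw hr
    obtain ⟨fuel, rfl⟩ : ∃ k, fuel = k + 1 := ⟨fuel - 1, by omega⟩
    refine (Runs.loop_succ (u := 47 * r) (runs_fbsBody hS hw hF ha hb hab hbw hr) ?_ ?_).mono
      (by omega) fun _ h => h
    · rintro ⟨a', b'⟩ ⟨ha', hb', hab', hbw', k, hk, hk'⟩
      exact (ih k hk (by omega) ha' hb' hab' hbw' hk').mono (by omega) fun _ h => h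
    · exact fun _ h => h

/-- `t` is the length of the name of the exit node of `x`. -/
def IsExitLen (w : ℕ) (S : Finset ℕ) (x t : ℕ) : Prop :=
  ∃ e ∈ exitNodes w S (w, x), nameLen w S e = t

/-- A node is the exit node of `x` if its name begins `x` and its extent is longer than all
branching prefixes of `x`. -/
theorem isExitLen_of_name_begins {e : BStr} {x : ℕ} (he : e ∈ nodes w S)
    (hn : Begins (name w S e) (w, x)) (hlt : ∀ l, Anc w S x l → l < e.1) :
    IsExitLen w S x (nameLen w S e) := by
  refine ⟨e, Finset.mem_filter.2 ⟨he, hn, ?_⟩, rfl⟩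
  by_cases hb : Begins e (w, x)
  · refine .inl (hb.eq_of_length ?_)
    by_contra! h
    exact lt_irrefl _ (hlt _ (anc_of_begins (mem_internals_of_length_lt he h) hb))
  · exact .inr hb

/-- The node at the root of the trie. -/
theorem exists_root (hS : S.Nonempty) (hw : ∀ y ∈ S, y < 2 ^ w) :
    ∃ e ∈ nodes w S, name w S e = (0, 0) := by
  obtain ⟨y, hy⟩ := hS
  have h0 : Begins (0, 0) (w, y) := begins_iff.2 ⟨Nat.zero_le _, Nat.div_eq_of_lt (hw y hy)⟩
  obtain ⟨e, he, hb, hl, -⟩ := exists_locus (q := (0, 0)) hw ⟨y, hy, h0⟩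
  exact ⟨e, he, (hb.name_begins hl).eq_of_length (Nat.zero_le _)⟩

/-- Below the last branching prefix of `x` hangs the exit node of `x`. -/
theorem isExitLen_succ (hw : ∀ y ∈ S, y < 2 ^ w) {x a : ℕ} (ha : Anc w S x a)
    (hmax : ∀ l, Anc w S x l → l ≤ a) : IsExitLen w S x (a + 1) := by
  have haw := ha.lt
  obtain ⟨y, hy, hq⟩ : ∃ y ∈ S, Begins (take (w, x) (a + 1)) (w, y) := by
    obtain ⟨h0, h1⟩ := mem_internals.1 ha
    have hd : x / 2 ^ (w - a) = x / 2 ^ (w - (a + 1)) / 2 := by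
      rw [Nat.div_div_eq_div_mul, ← pow_succ]; congr 2; omega
    simp only [take] at h0 h1 ⊢
    rcases Nat.mod_two_eq_zero_or_one (x / 2 ^ (w - (a + 1))) with h | h
    · rwa [show 2 * (x / 2 ^ (w - a)) = x / 2 ^ (w - (a + 1)) by omega] at h0
    · rwa [show 2 * (x / 2 ^ (w - a)) + 1 = x / 2 ^ (w - (a + 1)) by omega] at h1
  obtain ⟨e, he, hqe, hl, -⟩ := exists_locus hw ⟨y, hy, hq⟩
  have hqx : Begins (take (w, x) (a + 1)) (w, x) := take_begins haw
  have hlen : a + 1 ≤ e.1 := hqe.le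
  have hae : Begins (take (w, x) a) e :=
    ((take_begins haw.le).of_le hqx (Nat.le_succ a)).trans hqe
  have hlt : a < nameLen w S e := lt_nameLen ha hae hlen
  have heq : nameLen w S e = a + 1 := le_antisymm hl hlt
  rw [← heq]
  refine isExitLen_of_name_begins he ((hqe.name_begins hl).trans hqx) fun l h => ?_
  have := hmax l h
  omega

theorem runs_fbsP (hS : S.Nonempty) (hw : ∀ y ∈ S, y < 2 ^ w) (hF : Stores w S F) {x a b r : ℕ}
    (hx : x < 2 ^ w)
    (ha : a = 0 ∨ Anc w S x a) (hb : ∀ l, Anc w S x l → l < b) (hab : a < b) (hbw : b ≤ w)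
    (hr : a / 2 ^ r = (b - 1) / 2 ^ r) (hrw : r ≤ w) :
    Runs w S F (fbsP w S.card x a b) (47 * (r + 1) + 31) (IsExitLen w S x) := by
  refine (runs_fbsLoop hS hw hF r (Nat.lt_succ_of_le hrw) ha hb hab hbw hr).bind ?_
  rintro a ⟨ha, hmax⟩
  refine (runs_extentP hS hw _).bind (u := 3) ?_
  rintro _ rfl
  obtain ⟨e, he, hn⟩ := exists_root hS hw
  have hext : extentVal w S F (0, 0) = e := hn ▸ extentVal_name hw hF he
  rw [hext]
  have hx0 : Begins (0, 0) (w, x) := begins_iff.2 ⟨Nat.zero_le _, Nat.div_eq_of_lt hx⟩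
  have hadd : Anc w S x a → IsExitLen w S x ((a + 1) % 2 ^ w) := fun h => by
    have := h.lt
    have := w.lt_two_pow_self
    rw [Nat.mod_eq_of_lt (by omega)]
    exact isExitLen_succ hw h hmax
  refine Runs.test_ite (t := 2) rfl (fun h0 => ?_) (fun h0 => ?_)
  · subst h0
    refine Runs.test_ite (t := 1) rfl (fun he0 => ?_) (fun he0 => ?_)
    · refine (Runs.exec _).mono le_rfl ?_
      rintro _ rfl
      have hee : (0, 0) = e := (hn ▸ name_begins e : Begins (0, 0) e).eq_of_length he0.le
      subst hee
      exact hadd (anc_of_begins (mem_internals_of_length_lt he (by omega)) hx0)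
    · refine Runs.pure ?_
      rw [show 0 = nameLen w S e from (congrArg Prod.fst hn).symm]
      refine isExitLen_of_name_begins he (hn ▸ hx0) fun l hl => ?_
      have := hmax l hl
      omega
  · refine (Runs.exec _).mono (by omega) ?_
    rintro _ rfl
    exact hadd (ha.resolve_left h0)

theorem runs_decP {i : ℕ} (hi : i < 2 ^ w) : Runs w S F (decP i) 2 (· = decVal i) := by
  refine Runs.test_ite (t := 1) rfl (fun h0 => Runs.pure (by simp [decVal, h0])) fun h0 => ?_
  refine Runs.exec_bind (Runs.pure ?_)
  rw [Instr.result, sub_mod_word hi (by omega)]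
  simp [decVal, h0]

theorem runs_decP_isPredIndex (hw : ∀ y ∈ S, y < 2 ^ w) {q : BStr} {x i lo hi : ℕ}
    (hi' : i < S.card) (hlo : nth S i = lo) (h : IsRange w S q lo hi) (hqx : Begins q (w, x))
    (hx : x ≤ lo) : Runs w S F (decP i) 2 (IsPredIndex S x) := by
  refine (runs_decP (hi'.trans_le (card_le hw))).mono le_rfl ?_
  rintro _ rfl
  refine isPredIndex_decVal hi' (hlo ▸ hx) fun y hy hlt => ?_
  rw [hlo] at hlt
  exact lt_of_not_begins hqx h.begins_lo (fun hqy => (h.lo_le y hy hqy).not_gt hlt) hlt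

theorem IsRange.isPredIndex_hi {q : BStr} {x i lo hi : ℕ}
    (hi' : i < S.card) (hhi : nth S i = hi) (h : IsRange w S q lo hi) (hqx : Begins q (w, x))
    (hx : hi < x) : IsPredIndex S x (some i) := by
  refine isPredIndex_some hi' (hhi ▸ hx) fun y hy hlt => ?_
  rw [hhi] at hlt
  exact (lt_of_begins_of_lt_of_not_begins hqx h.begins_hi
    (fun hqy => (h.le_hi y hy hqy).not_gt hlt) hlt).le

theorem runs_predP (hS : S.Nonempty) (hw : ∀ y ∈ S, y < 2 ^ w) (hF : Stores w S F) {x t : ℕ}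
    (ht : IsExitLen w S x t) : Runs w S F (predP w S.card x t) 45 (IsPredIndex S x) := by
  obtain ⟨e, he, rfl⟩ := ht
  obtain ⟨hen, hnx, hex⟩ := Finset.mem_filter.1 he
  obtain ⟨lo, hi, hr⟩ := exists_isRange (exists_begins_of_mem_nodes hen)
  obtain ⟨hlo, hhi, hext⟩ := nth_name hw hF hen hr
  have hr' := hr.of_name hw hen (name_begins e) le_rfl
  have hew : e.1 ≤ w := hr.begins_lo.le
  refine (runs_takeP _ _ _).bind (u := 43) ?_
  rintro _ rfl
  rw [show (nameLen w S e, takeVal w w x (nameLen w S e)) = name w S e from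
    pair_takeVal hnx le_rfl]
  refine (runs_extentP hS hw _).bind (u := 15) ?_
  rintro _ rfl
  rw [hext]
  refine (runs_takeP _ _ _).bind (u := 13) ?_
  rintro _ rfl
  rw [takeVal_eq le_rfl hew]
  refine Runs.test_ite (t := 12) rfl (fun h => ?_) (fun h => ?_)
  · refine (runs_leftP _).bind (u := 3) ?_
    rintro _ rfl
    refine (runs_decP_isPredIndex hw (rankVal_lt hS _ _) hlo hr' hnx ?_).mono
      (by omega) fun _ h => h
    rcases hex with rfl | hex
    · have := hr.begins_lo.eq_of_length le_rfl
      exact (congrArg Prod.snd this).le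
    · by_contra! hlt
      have h1 := (begins_iff.1 hr.begins_lo).2
      have h2 := Nat.div_le_div_right (c := 2 ^ (w - e.1)) hlt.le
      simp only at h1
      exact hex (begins_iff.2 ⟨hew, by simp only; omega⟩)
  · refine (runs_rightP _).bind (u := 0) ?_
    rintro _ rfl
    refine Runs.pure (hr'.isPredIndex_hi (rankVal_lt hS _ _) hhi hnx ?_)
    by_contra! hle
    have h1 := (begins_iff.1 hr.begins_hi).2
    have h2 := Nat.div_le_div_right (c := 2 ^ (w - e.1)) hle
    simp only at h1
    omega

theorem runs_fbsPredP (hS : S.Nonempty) (hw : ∀ y ∈ S, y < 2 ^ w) (hF : Stores w S F)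
    {x a b r : ℕ} (hx : x < 2 ^ w)
    (ha : a = 0 ∨ Anc w S x a) (hb : ∀ l, Anc w S x l → l < b) (hab : a < b) (hbw : b ≤ w)
    (hr : a / 2 ^ r = (b - 1) / 2 ^ r) (hrw : r ≤ w) :
    Runs w S F (fbsPredP w S.card x a b) (47 * (r + 1) + 76) (IsPredIndex S x) :=
  (runs_fbsP hS hw hF hx ha hb hab hbw hr hrw).bind (u := 45) fun _ ht => runs_predP hS hw hF ht

/-! ### The long-distance algorithm -/

theorem longDistance_lt {x B : ℕ} (hB : 0 < B) (h1 : ∀ y ∈ S, x ≤ y → (∀ z ∈ S, x ≤ z → y ≤ z) →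
    y - x < B) (h2 : ∀ y ∈ S, y < x → (∀ z ∈ S, z < x → z ≤ y) → x - y < B) :
    longDistance S x < B := by
  refine max_lt ?_ ?_
  · rcases (S.filter fun y => x ≤ y).eq_empty_or_nonempty with h | h
    · simp [h, hB]
    · obtain ⟨y, hy⟩ := Finset.min_of_nonempty h
      rw [hy]
      have hm := Finset.mem_filter.1 (Finset.mem_of_min hy)
      exact h1 y hm.1 hm.2 fun z hz hxz => Finset.min_le_of_eq (Finset.mem_filter.2 ⟨hz, hxz⟩) hy
  · rcases (S.filter fun y => y < x).eq_empty_or_nonempty with h | h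
    · simp [h, hB]
    · obtain ⟨y, hy⟩ := Finset.max_of_nonempty h
      rw [hy]
      have hm := Finset.mem_filter.1 (Finset.mem_of_max hy)
      exact h2 y hm.1 hm.2 fun z hz hxz => Finset.le_max_of_eq (Finset.mem_filter.2 ⟨hz, hxz⟩) hy

/-- If `x` lies between two elements of `S` that begin with `e`, then so do the two neighbours of
`x` in `S`, so that they are close to `x`. -/
theorem longDistance_lt_of_begins {e : BStr} {x lo hi : ℕ} (hlo : lo ∈ S) (hhi : hi ∈ S)
    (h1 : Begins e (w, lo)) (h2 : Begins e (w, hi)) (hx : lo < x) (hx' : x ≤ hi) :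
    longDistance S x < 2 ^ (w - e.1) := by
  have he : e.1 ≤ w := h1.le
  rw [begins_iff_mem_Ico he] at h1 h2
  have hp : 0 < 2 ^ (w - e.1) := by positivity
  rw [Nat.add_mul] at h1 h2
  refine longDistance_lt hp (fun y _ _ hy => ?_) (fun y _ _ hy => ?_)
  · have := hy hi hhi hx'
    omega
  · have := hy lo hlo hx
    omega

/-- The body of the loop of the long-distance algorithm. -/
def longBody (w n x a : ℕ) : RAM (ℕ ⊕ Option ℕ) := do
  let c ← exec (.add a a)
  if ← test (.lt c w) then
    let k ← exec (.size a)
    let m ← exec (.shl 1 k)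
    let v ← takeP w x m
    match ← fHatP w n (m, v) with
    | none =>
      let r ← fbsPredP w n x a m
      return .inr r
    | some t =>
      let p ← takeP w x t
      let i ← leftP w n (t, p)
      let y ← exec (.access i)
      if ← test (.le x y) then
        let r ← decP i
        return .inr r
      else
        let j ← rightP w n (t, p)
        let z ← exec (.access j)
        if ← test (.lt z x) then return .inr (some j)
        else
          let e ← extentP w n (t, p)
          return .inl e.1
  else
    let r ← fbsPredP w n x a w
    return .inr r

/-- The least power of two larger than `a` is `2 ^ Nat.size a`; if it belongs to a skip interval
above `a`, then it is the smallest power of two in it. -/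
theorem cutMap_two_pow_size (hw : ∀ y ∈ S, y < 2 ^ w) (hF : Stores w S F) {x a : ℕ} {e : BStr}
    (he : e ∈ internals w S) (hm : 2 ^ Nat.size a ∈ skip w S e) (hsk : ∀ g ∈ skip w S e, a < g)
    (hq : Begins (take (w, x) (2 ^ Nat.size a)) e) :
    F .cutMap (take (w, x) (2 ^ Nat.size a)) = nameLen w S e := by
  have := hq.take_eq
  rw [← this]
  refine cutMap_eq hw hF he hm fun j hj => Nat.pow_le_pow_right two_pos ?_
  exact Nat.size_le.2 (hsk _ hj)

/-- The condition under which the patched function accepts the stored value. -/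
def Accepts (w : ℕ) (S : Finset ℕ) (F : Table → BStr → ℕ) (q : BStr) : Prop :=
  F .cutMap q ≤ q.1 ∧ Begins q (extentVal w S F (F .cutMap q, takeVal w q.1 q.2 (F .cutMap q)))

/-- If a value is rejected, then no branching prefix of `x` is as long as the string looked up,
since the values stored for cut extents are accepted. -/
theorem lt_of_not_accepts (hw : ∀ y ∈ S, y < 2 ^ w) (hF : Stores w S F) {x a : ℕ}
    (ha : a = 0 ∨ Anc w S x a) (hm : 2 ^ Nat.size a ≤ w)
    (h : ¬ Accepts w S F (take (w, x) (2 ^ Nat.size a))) :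
    ∀ l, Anc w S x l → l < 2 ^ Nat.size a := by
  intro l hl
  by_contra! hfl
  obtain ⟨e, he, hex, -, hms, hsk⟩ := exists_skip_of_anc hw ha (Nat.lt_size_self a) hl hfl
  have hms' := Finset.mem_Icc.1 hms
  have hqe : Begins (take (w, x) (2 ^ Nat.size a)) e := (take_begins hm).of_le hex hms'.2
  have hnl : nameLen w S e ≤ 2 ^ Nat.size a := (le_max_right _ _).trans hms'.1
  have hv := cutMap_two_pow_size hw hF he hms hsk hqe
  refine h ⟨hv ▸ hnl, ?_⟩
  have := pair_takeVal (hqe.name_begins hnl) hm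
  rw [hv, show nameLen w S e = (name w S e).1 from rfl, this,
    extentVal_name hw hF (mem_nodes_of_mem_internals he)]
  exact hqe

/-- If a value is accepted, then the range found with it is the range of a prefix of `x`, even
if the stored value is arbitrary: in that case only one element of `S` begins with the
string looked up, and the test of acceptance ensures that this element is found. -/
theorem exists_isRange_of_accepts (hS : S.Nonempty) (hw : ∀ y ∈ S, y < 2 ^ w) (hF : Stores w S F)
    {x a t : ℕ} {q' : BStr} (ha : a = 0 ∨ Anc w S x a) (hm : 2 ^ Nat.size a ≤ w)
    (h : Accepts w S F (take (w, x) (2 ^ Nat.size a)))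
    (ht : t = F .cutMap (take (w, x) (2 ^ Nat.size a))) (hq' : q' = take (w, x) t) :
    ∃ q, Begins q (w, x) ∧
      IsRange w S q (nth S (leftVal w S F q')) (nth S (rightVal w S F q')) ∧
      Begins (take (w, x) (2 ^ Nat.size a)) (extentVal w S F q') := by
  obtain ⟨h1, h2⟩ := h
  rw [← ht] at h1 h2
  set q := take (w, x) (2 ^ Nat.size a) with hq
  have hqx : Begins q (w, x) := take_begins hm
  have h1' : t ≤ 2 ^ Nat.size a := h1
  have hq'q : Begins q' q := hq' ▸ (take_begins (h1'.trans hm)).of_le hqx h1'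
  rw [show (t, takeVal w q.1 q.2 t) = q' from by
    have := pair_takeVal hq'q hm
    rwa [show q'.1 = t from hq' ▸ rfl] at this] at h2
  have hy := nth_leftVal_mem (w := w) (F := F) hS q'
  have hz := nth_rightVal_mem (w := w) (F := F) hS q'
  obtain ⟨hqy, hqz⟩ := (begins_lcp (size_xor_le (hw _ hy) (hw _ hz))).1 h2
  obtain ⟨e, he, hqe, hnl, hall⟩ := exists_locus hw ⟨_, hy, hqy⟩
  rcases mem_nodes.1 he with hint | ⟨y, hyS, rfl⟩
  · -- The string looked up is the cut extent of `e`.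
    have hme : 2 ^ Nat.size a ≤ e.1 := hqe.le
    have hlt := Nat.lt_size_self a
    have hv : t = nameLen w S e := by
      rw [ht]
      refine cutMap_two_pow_size hw hF hint
        (Finset.mem_Icc.2 ⟨max_le Nat.one_le_two_pow hnl, hme⟩) (fun g hg => ?_) hqe
      have hg1 := (Finset.mem_Icc.1 hg).1
      rcases ha with rfl | ha
      · omega
      · have := lt_nameLen (e := e) ha
          (((take_begins ha.lt.le).of_le hqx hlt.le).trans hqe) (hlt.trans_le hme)
        simp only [take] at this
        omega
    have hname : q' = name w S e := by
      rw [hq', hv]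
      exact ((hqe.name_begins hnl).trans hqx).take_eq
    obtain ⟨lo, hi, hr⟩ := exists_isRange (exists_begins_of_mem_nodes he)
    obtain ⟨hlo, hhi, -⟩ := nth_name hw hF he hr
    refine ⟨q', hq'q.trans hqx, ?_, h2⟩
    rw [hname, hlo, hhi]
    exact hr.of_name hw he (name_begins e) le_rfl
  · -- The stored value is arbitrary, but `y` is the only element of `S` that begins with `q`.
    have huniq : ∀ z ∈ S, Begins q (w, z) → z = y := fun z hz hqz =>
      (congrArg Prod.snd ((hall z hz hqz).eq_of_length le_rfl)).symm
    refine ⟨q, hqx, ⟨hy, hz, hqy, hqz, fun z hzS hqz' => ?_, fun z hzS hqz' => ?_⟩, h2⟩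
    · rw [huniq _ hy hqy, huniq z hzS hqz']
    · rw [huniq _ hz hqz, huniq z hzS hqz']

theorem two_mul_lt_two_pow {a : ℕ} (h : a < w) : a + a < 2 ^ w := by
  obtain ⟨v, rfl⟩ : ∃ v, w = v + 1 := ⟨w - 1, by omega⟩
  have := v.lt_two_pow_self
  rw [pow_succ]
  omega

/-- One round of the long-distance algorithm.  The budget `B` has to cover fat binary search only
if the round is the last one. -/
theorem runs_longBody (hS : S.Nonempty) (hw : ∀ y ∈ S, y < 2 ^ w) (hF : Stores w S F) {x a : ℕ}
    (hx : x < 2 ^ w) (ha : a = 0 ∨ Anc w S x a) (haw : a < w) {B : ℕ} (hB : 97 ≤ B)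
    (hB' : ¬ (a + a < w ∧ Accepts w S F (take (w, x) (2 ^ Nat.size a))) →
      47 * (Nat.size a + 2) + 118 ≤ B) :
    Runs w S F (longBody w S.card x a) B fun
      | .inl a' => (a + a < w ∧ Accepts w S F (take (w, x) (2 ^ Nat.size a))) ∧
          2 ^ Nat.size a ≤ a' ∧ Anc w S x a' ∧ longDistance S x < 2 ^ (w - a')
      | .inr r => IsPredIndex S x r := by
  set P : ℕ ⊕ Option ℕ → Prop := fun
      | .inl a' => (a + a < w ∧ Accepts w S F (take (w, x) (2 ^ Nat.size a))) ∧
          2 ^ Nat.size a ≤ a' ∧ Anc w S x a' ∧ longDistance S x < 2 ^ (w - a')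
      | .inr r => IsPredIndex S x r
  have h2w := w.lt_two_pow_self
  have hasz := Nat.lt_size_self a
  have hinr : ∀ {p : RAM (Option ℕ)} {t : ℕ}, Runs w S F p t (IsPredIndex S x) →
      Runs w S F (p >>= fun r => pure (Sum.inr r)) t P := fun hp =>
    hp.bind (u := 0) fun r h => Runs.pure h
  -- The `42` steps up to the answer of the patched function are set apart from the budget.
  obtain ⟨B, rfl⟩ : ∃ B', B = B' + 42 := ⟨B - 42, by omega⟩
  refine Runs.exec_bind (Runs.test_ite (t := B + 40) rfl (fun hc => ?_) (fun hc => ?_))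
  · rw [Instr.result, Nat.mod_eq_of_lt (two_mul_lt_two_pow haw)] at hc
    have hmw : 2 ^ Nat.size a ≤ w := by
      rcases Nat.eq_zero_or_pos a with rfl | ha0
      · exact haw
      · obtain ⟨k, hk⟩ : ∃ k, Nat.size a = k + 1 :=
          ⟨Nat.size a - 1, by have := Nat.size_pos.2 ha0; omega⟩
        have : 2 ^ k ≤ a := Nat.lt_size.1 (by omega)
        rw [hk, pow_succ]
        omega
    refine Runs.exec_bind (Runs.exec_bind (t := B + 38) ?_)
    rw [show (Instr.shl 1 ((Instr.size a).result w S F)).result w S F = 2 ^ Nat.size a by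
      simp only [Instr.result, one_mul]; exact Nat.mod_eq_of_lt (by omega)]
    refine ((runs_takeP _ _ _).bind (u := B + 36) ?_).mono (by omega)
      fun _ h => h
    rintro _ rfl
    rw [show (2 ^ Nat.size a, takeVal w w x (2 ^ Nat.size a)) = take (w, x) (2 ^ Nat.size a) by
      rw [takeVal_eq le_rfl hmw]; rfl]
    refine ((runs_fHatP hS hw _).bind (u := B) ?_).mono (by omega)
      fun _ h => h
    rintro _ rfl
    by_cases hacc : Accepts w S F (take (w, x) (2 ^ Nat.size a))
    · rw [if_pos (show _ ∧ _ from hacc)]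
      set t := F .cutMap (take (w, x) (2 ^ Nat.size a)) with ht
      have htm : t ≤ 2 ^ Nat.size a := hacc.1
      refine Runs.mono (t := 55) ?_ (by omega) fun _ h => h
      refine (runs_takeP _ _ _).bind (u := 53) ?_
      rintro _ rfl
      obtain ⟨q, hqx, hrange, hqe⟩ := exists_isRange_of_accepts hS hw hF ha hmw hacc ht
        (q' := (t, takeVal w w x t)) (by rw [takeVal_eq le_rfl (htm.trans hmw)]; rfl)
      set q' := (t, takeVal w w x t)
      refine (runs_leftP q').bind (u := 44) ?_
      rintro _ rfl
      refine Runs.exec_bind (Runs.test_ite (t := 42) rfl (fun hle => ?_) (fun hle => ?_))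
      · exact (hinr (runs_decP_isPredIndex hw (rankVal_lt hS _ _) rfl hrange hqx hle)).mono
          (by omega) fun _ h => h
      · refine (runs_rightP q').bind (u := 30) ?_
        rintro _ rfl
        refine Runs.exec_bind (Runs.test_ite (t := 28) rfl (fun hlt => ?_) (fun hlt => ?_))
        · exact Runs.pure
            (show P (.inr _) from hrange.isPredIndex_hi (rankVal_lt hS _ _) rfl hqx hlt)
        · refine (runs_extentP hS hw q').bind (u := 0) ?_
          rintro _ rfl
          simp only [Instr.result, not_le, not_lt] at hle hlt
          have hs := size_xor_le (hw _ hrange.lo_mem) (hw _ hrange.hi_mem)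
          have hb1 : Begins (extentVal w S F q') _ := lcp_begins_left
          have hb2 : Begins (extentVal w S F q') _ := lcp_begins_right hs
          have hint : extentVal w S F q' ∈ internals w S :=
            lcp_mem_internals hrange.lo_mem hrange.hi_mem hs (hle.trans_le hlt).ne
          exact Runs.pure ⟨⟨hc, hacc⟩, hqe.le,
            anc_of_begins hint (begins_of_mem_Icc hb1 hb2 hle.le hlt),
            longDistance_lt_of_begins hrange.lo_mem hrange.hi_mem hb1 hb2 hle hlt⟩
    · rw [if_neg (show ¬ (_ ∧ _) from hacc)]
      have hbig := hB' fun h => hacc h.2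
      refine (hinr (runs_fbsPredP (r := Nat.size a) hS hw hF hx ha
        (lt_of_not_accepts hw hF ha hmw hacc) hasz hmw ?_ ?_)).mono (by omega) fun _ h => h
      · rw [Nat.div_eq_of_lt hasz, Nat.div_eq_of_lt]
        have : 0 < 2 ^ Nat.size a := by positivity
        omega
      · exact (Nat.lt_two_pow_self.trans_le hmw).le
  · rw [Instr.result, Nat.mod_eq_of_lt (two_mul_lt_two_pow haw)] at hc
    have hbig := hB' fun h => hc h.1
    have hp : 2 ^ (Nat.size a + 1) = 2 * 2 ^ Nat.size a := by ring
    refine (hinr (runs_fbsPredP (r := Nat.size a + 1) hS hw hF hx ha (fun l h => h.lt) haw le_rfl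
      ?_ ?_)).mono (by omega) fun _ h => h
    · rw [Nat.div_eq_of_lt, Nat.div_eq_of_lt] <;> omega
    · have : Nat.size a ≤ w - 1 := Nat.size_le.2 ((show a ≤ w - 1 by omega).trans_lt
        (w - 1).lt_two_pow_self)
      omega

end

/-! ### The time bound -/

section
variable {w : ℕ} {S : Finset ℕ} {F : Table → BStr → ℕ}

/-- A round that is not the last one pays its constant cost from the growth of `Nat.size a`, which
is at most `Nat.size L`. -/
theorem runs_longLoop (hS : S.Nonempty) (hw : ∀ y ∈ S, y < 2 ^ w) (hF : Stores w S F) {x L : ℕ}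
    (hx : x < 2 ^ w) (hL : ∀ l < w, longDistance S x < 2 ^ (w - l) → l ≤ L) :
    ∀ {fuel a T : ℕ}, w < fuel + a → (a = 0 ∨ Anc w S x a) → a < w →
      longDistance S x < 2 ^ (w - a) → 165 * Nat.size L + 212 ≤ T + 118 * Nat.size a →
      Runs w S F (loop (longBody w S.card x) fuel a) T (IsPredIndex S x) := by
  intro fuel
  induction fuel with
  | zero => intro a T hfuel _ haw; omega
  | succ fuel ih =>
    intro a T hfuel ha haw hD hT
    have haL := Nat.size_le_size (hL a haw hD)
    by_cases hacc : a + a < w ∧ Accepts w S F (take (w, x) (2 ^ Nat.size a))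
    · refine (Runs.loop_succ (u := T - 118) (runs_longBody hS hw hF hx ha haw (B := 118) (by omega)
        fun h => absurd hacc h) ?_ fun _ h => h).mono (by omega) fun _ h => h
      rintro a' ⟨-, h1, h2, h3⟩
      have h4 := Nat.lt_size.2 h1
      exact ih (by have := Nat.lt_size_self a; omega) (.inr h2) h2.lt h3 (by omega)
    · refine (Runs.loop_succ (u := 0) (runs_longBody hS hw hF hx ha haw
        (B := 47 * (Nat.size a + 2) + 118) (by omega) fun _ => le_rfl) ?_ fun _ h => h).mono
        (by omega) fun _ h => h
      exact fun a' h => absurd h.1 hacc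

theorem one_le_lg (y : ℝ) : 1 ≤ lg y := by
  unfold lg
  split_ifs with h
  · exact le_rfl
  · rw [Real.le_logb_iff_rpow_le one_lt_two (by linarith)]
    simpa using h

theorem lg_mono {y z : ℝ} (h : y ≤ z) : lg y ≤ lg z := by
  by_cases hy : y < 2
  · rw [lg, if_pos hy]
    exact one_le_lg z
  · rw [lg, if_neg hy, lg, if_neg (by linarith)]
    exact Real.logb_le_logb_of_le one_lt_two (by linarith) h

theorem size_le_lg (n : ℕ) : (Nat.size n : ℝ) ≤ 2 * lg n := by
  have h1 := one_le_lg n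
  rcases Nat.lt_or_ge n 2 with h | h
  · have : Nat.size n ≤ 1 := Nat.size_le.2 (by simpa using h)
    have : (Nat.size n : ℝ) ≤ 1 := by exact_mod_cast this
    linarith
  · obtain ⟨k, hk⟩ : ∃ k, Nat.size n = k + 1 :=
      ⟨Nat.size n - 1, by have := Nat.size_pos.2 (show 0 < n by omega); omega⟩
    have h2 : 2 ^ k ≤ n := Nat.lt_size.1 (by omega)
    have h3 : (k : ℝ) ≤ lg n := by
      rw [lg, if_neg (by exact_mod_cast h.not_gt),
        Real.le_logb_iff_rpow_le one_lt_two (by positivity), Real.rpow_natCast]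
      exact_mod_cast h2
    rw [hk]
    push_cast
    linarith

theorem lg_le_size {n : ℕ} (h : 2 ≤ n) : lg n ≤ Nat.size n := by
  rw [lg, if_neg (by exact_mod_cast h.not_gt),
    Real.logb_le_iff_le_rpow one_lt_two (by positivity), Real.rpow_natCast]
  exact_mod_cast (Nat.lt_size_self n).le

theorem exists_run_longPredP (hw0 : 0 < w) (hS : S.Nonempty) (hw : ∀ y ∈ S, y < 2 ^ w)
    (hF : Stores w S F) {x : ℕ} (hx : x < 2 ^ w) :
    ∃ (r : Option ℕ) (t : ℕ), (longPredP w S.card x).run w S F = some (r, t) ∧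
      IsPredIndex S x r ∧ (t : ℝ) ≤ 600 * lg ((w : ℝ) - lg (longDistance S x)) := by
  set D := longDistance S x with hD
  have hDw : D < 2 ^ w := longDistance_lt (by positivity)
    (fun y hy _ _ => (Nat.sub_le _ _).trans_lt (hw y hy))
    fun y _ _ _ => (Nat.sub_le _ _).trans_lt hx
  -- The bound `w - 1` is needed for `D = 0`, as `lg 0 = 1` exceeds `Nat.size 0 = 0`.
  set L := min (w - 1) (w - Nat.size D) with hL
  have hDs : Nat.size D ≤ w := Nat.size_le.2 hDw
  have hLD : (L : ℝ) ≤ w - lg D := by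
    by_cases h : D < 2
    · have h1 : ((L + 1 : ℕ) : ℝ) ≤ w := by exact_mod_cast (by omega : L + 1 ≤ w)
      rw [lg, if_pos (by exact_mod_cast h)]
      push_cast at h1
      linarith
    · have h1 : ((L + Nat.size D : ℕ) : ℝ) ≤ w := by exact_mod_cast (by omega : L + Nat.size D ≤ w)
      have h2 := lg_le_size (not_lt.1 h)
      push_cast at h1
      linarith
  obtain ⟨r, t, hrun, ht, hr⟩ := runs_longLoop (L := L) hS hw hF hx
    (fun l hl h => le_min (by omega) (by have : Nat.size D ≤ w - l := Nat.size_le.2 h; omega))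
    (fuel := w + 1) (a := 0) (T := 165 * Nat.size L + 212) (by omega) (.inl rfl) hw0 hDw (by omega)
  refine ⟨r, t, hrun, hr, ?_⟩
  have h1 : (t : ℝ) ≤ 165 * Nat.size L + 212 := by exact_mod_cast ht
  have h2 := size_le_lg L
  have h3 := lg_mono hLD
  have h4 := one_le_lg L
  linarith

/-! ### Space -/

/-- The smallest element of `S` in the right branch of an internal node determines the node. -/
theorem card_internals_le : (internals w S).card ≤ S.card := by
  have hex : ∀ e : BStr, ∃ y, e ∈ internals w S → y ∈ S ∧
      Begins (e.1 + 1, 2 * e.2 + 1) (w, y) ∧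
      ∀ z ∈ S, Begins (e.1 + 1, 2 * e.2 + 1) (w, z) → y ≤ z := by
    intro e
    by_cases he : e ∈ internals w S
    · obtain ⟨lo, hi, h⟩ := exists_isRange (mem_internals.1 he).2
      exact ⟨lo, fun _ => ⟨h.lo_mem, h.begins_lo, h.lo_le⟩⟩
    · exact ⟨0, fun h => absurd h he⟩
  choose f hf using hex
  refine Finset.card_le_card_of_injOn f (fun e he => (hf e he).1) ?_
  intro e he e' he' heq
  wlog hle : e.1 ≤ e'.1 generalizing e e'
  · exact (this he' he heq.symm (by omega)).symm
  obtain ⟨-, hb, hmin⟩ := hf e he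
  obtain ⟨-, hb', -⟩ := hf e' he'
  have hee' : Begins e e' := by
    rw [← heq] at hb'
    exact (begins_pair (v := e.2) hb (by omega)).of_le (begins_pair (v := e'.2) hb' (by omega)) hle
  refine hee'.eq_of_length ?_
  by_contra! hlt
  obtain ⟨⟨z, hz, hbz⟩, -⟩ := mem_internals.1 he'
  have h1 : Begins (e.1 + 1, 2 * e.2 + 1) e' := by
    rw [← heq] at hb'
    exact hb.of_le (begins_pair (v := e'.2) hb' (by omega)) hlt
  have h2 := hmin z hz (h1.trans (begins_pair hbz (by omega)))
  rw [heq] at h2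
  have h3 := (begins_iff.1 hbz).2
  have h4 := (begins_iff.1 hb').2
  have h5 := Nat.div_le_div_right (c := 2 ^ (w - (e'.1 + 1))) h2
  simp only at h3 h4
  omega

theorem card_nodes_le : (nodes w S).card ≤ 2 * S.card := by
  have h1 := Finset.card_union_le (internals w S) (S.image fun y => (w, y))
  have h2 := Finset.card_image_le (s := S) (f := fun y => (w, y))
  have h3 := card_internals_le (w := w) (S := S)
  rw [nodes]
  omega

theorem card_ends_le (right : Bool) : (ends w S right).card ≤ 2 * S.card := by
  refine le_trans ?_ (card_nodes_le (w := w))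
  cases right <;> exact Finset.card_image_le.trans Finset.card_image_le

theorem card_cuts_le : (cuts w S).card ≤ S.card := by
  refine le_trans (Finset.card_biUnion_le_card_mul _ _ 1 fun e _ => ?_)
    ((mul_one _).trans_le card_internals_le)
  refine Finset.card_image_le.trans (Finset.card_le_one.2 fun m hm m' hm' => ?_)
  simp only [Finset.mem_filter] at hm hm'
  obtain ⟨h1, ⟨k, hk, rfl⟩, h2⟩ := hm
  obtain ⟨h1', ⟨k', hk', rfl⟩, h2'⟩ := hm'
  exact le_antisymm (h2 k' hk' h1') (h2' k hk h1)

/-- The key of a base depends only on the bucket. -/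
theorem bucketLcp_congr (hw : ∀ y ∈ S, y < 2 ^ w) {right : Bool} {d d' : ℕ}
    (hd : d ∈ ends w S right) (hd' : d' ∈ ends w S right)
    (h : bucketNo w S right d = bucketNo w S right d') :
    take (w, d) (bucketLcp w S right d) = take (w, d') (bucketLcp w S right d') := by
  have key : ∀ {d d' : ℕ}, d ∈ ends w S right → d' ∈ ends w S right →
      bucketNo w S right d = bucketNo w S right d' →
      bucketLcp w S right d ≤ bucketLcp w S right d' := by
    intro d d' hd hd' h
    refine Nat.le_findGreatest (bucketLcp_le _ _) fun u hu => ?_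
    have hu' : u ∈ bucket w S right d := by
      rw [bucket, h]
      exact hu
    rw [take_bucketLcp hw hd hu', take_bucketLcp hw hd (Finset.mem_filter.2 ⟨hd', h.symm⟩)]
  rw [le_antisymm (key hd hd' h) (key hd' hd h.symm)]
  exact take_bucketLcp hw hd' (Finset.mem_filter.2 ⟨hd, h⟩)

/-- There is one base for each bucket. -/
theorem card_baseKeys_le (hw : ∀ y ∈ S, y < 2 ^ w) (right : Bool) :
    (keys w S (.baseMap right)).card ≤ 2 * S.card / bucketSize S + 1 := by
  have hex : ∀ k : BStr, ∃ d, k ∈ keys w S (.baseMap right) →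
      d ∈ ends w S right ∧ take (w, d) (bucketLcp w S right d) = k := by
    intro k
    by_cases hk : k ∈ keys w S (.baseMap right)
    · obtain ⟨d, hd⟩ := Finset.mem_image.1 hk
      exact ⟨d, fun _ => hd⟩
    · exact ⟨0, fun h => absurd h hk⟩
  choose f hf using hex
  rw [← Finset.card_range (2 * S.card / bucketSize S + 1)]
  refine Finset.card_le_card_of_injOn (fun k => bucketNo w S right (f k)) (fun k _ => ?_) ?_
  · simp only [Finset.coe_range, Set.mem_Iio]
    exact Nat.lt_succ_of_le (Nat.div_le_div_right
      ((Finset.card_filter_le _ _).trans (card_ends_le right)))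
  · intro k hk k' hk' h
    obtain ⟨h1, h2⟩ := hf k hk
    obtain ⟨h1', h2'⟩ := hf k' hk'
    rw [← h2, ← h2']
    exact bucketLcp_congr hw h1 h1' h

theorem card_keys_le (T : Table) :
    (keys w S T).card ≤ 3 * S.card := by
  cases T with
  | handleMap => exact Finset.card_image_le.trans (card_internals_le.trans (by omega))
  | cutMap => exact card_cuts_le.trans (by omega)
  | lcpMap r => exact Finset.card_image_le.trans ((card_ends_le r).trans (by omega))
  | offsetMap r => exact Finset.card_image_le.trans ((card_ends_le r).trans (by omega))
  | baseMap r => exact Finset.card_image_le.trans ((card_ends_le r).trans (by omega))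

/-- The values of each function take `O(n log w)` bits in total: all but the bases are of
`O(log w)` bits, and there are so few bases that they take `O(n)` bits. -/
theorem width_mul_card_keys_le (hw0 : 0 < w) (hS : S.Nonempty) (hw : ∀ y ∈ S, y < 2 ^ w)
    (T : Table) : width w S T * (keys w S T).card ≤ 3 * S.card * Nat.size w := by
  have hpos := hS.card_pos
  have hsw : 0 < Nat.size w := Nat.size_pos.2 hw0
  have hgen : width w S T ≤ Nat.size w →
      width w S T * (keys w S T).card ≤ 3 * S.card * Nat.size w := fun h => by
    rw [mul_comm]
    exact Nat.mul_le_mul (card_keys_le T) h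
  cases T with
  | handleMap => exact hgen le_rfl
  | cutMap => exact hgen le_rfl
  | lcpMap r => exact hgen le_rfl
  | offsetMap r =>
    refine hgen (Nat.size_le_size ?_)
    -- The number `n` may be `2 ^ w`, which has `w + 1` bits.
    have : Nat.size S.card ≤ w + 1 := Nat.size_le.2 ((card_le hw).trans_lt
      (Nat.pow_lt_pow_right one_lt_two w.lt_succ_self))
    simp only [bucketSize]
    omega
  | baseMap r =>
    have h1 := card_baseKeys_le hw r
    have h2 : Nat.size (S.card - 1) ≤ bucketSize S := Nat.size_le_size (Nat.sub_le _ _)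
    have h3 : bucketSize S ≤ S.card := Nat.size_le.2 S.card.lt_two_pow_self
    have h4 := Nat.mul_div_le (2 * S.card) (bucketSize S)
    calc Nat.size (S.card - 1) * (keys w S (.baseMap r)).card
        ≤ bucketSize S * (2 * S.card / bucketSize S + 1) := Nat.mul_le_mul h2 h1
      _ ≤ 3 * S.card := by rw [mul_add, mul_one]; omega
      _ ≤ 3 * S.card * Nat.size w := Nat.le_mul_of_pos_right _ hsw

/-- The finitely many `k` at which `o k > k` are covered by an additive constant. -/
theorem exists_bound_of_isLittleO {o : ℕ → ℝ} (ho : o =o[atTop] (fun k : ℕ => (k : ℝ))) :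
    ∃ M : ℝ, 0 ≤ M ∧ ∀ k, o k ≤ k + M := by
  obtain ⟨K, hK⟩ := eventually_atTop.1 (ho.def one_pos)
  refine ⟨∑ k ∈ Finset.range K, |o k|, Finset.sum_nonneg fun _ _ => abs_nonneg _, fun k => ?_⟩
  rcases lt_or_ge k K with h | h
  · have h1 := Finset.single_le_sum (f := fun k => |o k|) (fun _ _ => abs_nonneg _)
      (Finset.mem_range.2 h)
    have h2 := le_abs_self (o k)
    have h3 : (0 : ℝ) ≤ k := k.cast_nonneg
    linarith
  · have h1 := hK k h
    rw [Real.norm_eq_abs, Real.norm_eq_abs, Nat.abs_cast, one_mul] at h1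
    have h2 := le_abs_self (o k)
    have h3 : 0 ≤ ∑ k ∈ Finset.range K, |o k| := Finset.sum_nonneg fun _ _ => abs_nonneg _
    linarith

theorem indexBits_le {bits : ℕ → ℕ → ℕ} {c M : ℝ} {o : ℕ → ℝ} (hc : 0 ≤ c) (hM : 0 ≤ M)
    (ho : ∀ k, o k ≤ k + M) (hbits : ∀ k r : ℕ, (bits k r : ℝ) ≤ r * k + c * k + o k)
    (hw0 : 0 < w) (hS : S.Nonempty) (hw : ∀ y ∈ S, y < 2 ^ w) :
    (indexBits bits w S : ℝ) ≤ 8 * (9 + 3 * c + M) * (S.card * lg w) := by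
  have hlg := one_le_lg w
  have hn : (1 : ℝ) ≤ S.card := by exact_mod_cast hS.card_pos
  have hT : ∀ T : Table, (bits (keys w S T).card (width w S T) : ℝ) ≤
      (9 + 3 * c + M) * (S.card * lg w) := by
    intro T
    have h1 : ((keys w S T).card : ℝ) ≤ 3 * S.card := by exact_mod_cast card_keys_le T
    have h2 : (width w S T : ℝ) * (keys w S T).card ≤ 3 * S.card * Nat.size w := by
      exact_mod_cast width_mul_card_keys_le hw0 hS hw T
    have h3 : (3 * S.card * Nat.size w : ℝ) ≤ 3 * S.card * (2 * lg w) :=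
      mul_le_mul_of_nonneg_left (size_le_lg w) (by positivity)
    have h4 : (S.card : ℝ) ≤ S.card * lg w := le_mul_of_one_le_right (by positivity) hlg
    have h5 : (c + 1) * (keys w S T).card ≤ (c + 1) * (3 * (S.card * lg w)) :=
      mul_le_mul_of_nonneg_left (by linarith) (by linarith)
    have h6 : M * 1 ≤ M * (S.card * lg w) := mul_le_mul_of_nonneg_left (by linarith) hM
    have h7 := hbits (keys w S T).card (width w S T)
    have h8 := ho (keys w S T).card
    linarith
  have h := List.sum_le_card_nsmul
    (allTables.map fun T => (bits (keys w S T).card (width w S T) : ℝ))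
    ((9 + 3 * c + M) * (S.card * lg w)) (by
      intro b hb
      obtain ⟨T, -, rfl⟩ := List.mem_map.1 hb
      exact hT T)
  rw [indexBits, Nat.cast_list_sum, List.map_map]
  refine h.trans_eq ?_
  simp only [List.length_map, allTables, List.length_cons, List.length_nil, nsmul_eq_mul]
  push_cast
  ring

end
end LongDist

theorem mainTheorem2 :
    (∃ C : ℝ, ∀ (w : ℕ) (S : Finset ℕ), 0 < w → S.Nonempty → (∀ y ∈ S, y < 2 ^ w) →
      ∀ F : LongDist.Table → LongDist.BStr → ℕ, LongDist.Stores w S F →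
      ∀ x : ℕ, x < 2 ^ w →
        ∃ (r : Option ℕ) (t : ℕ),
          (LongDist.longPredP w S.card x).run w S F = some (r, t) ∧
          LongDist.IsPredIndex S x r ∧
          (t : ℝ) ≤ C * LongDist.lg ((w : ℝ) - LongDist.lg (LongDist.longDistance S x))) ∧
    (∀ (bits : ℕ → ℕ → ℕ) (c : ℝ) (o : ℕ → ℝ), 0 ≤ c →
      o =o[atTop] (fun k : ℕ => (k : ℝ)) →
      (∀ k r : ℕ, (bits k r : ℝ) ≤ r * k + c * k + o k) →
      ∃ C : ℝ, ∀ (w : ℕ) (S : Finset ℕ), 0 < w → S.Nonempty → (∀ y ∈ S, y < 2 ^ w) →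
        (LongDist.indexBits bits w S : ℝ) ≤ C * (S.card * LongDist.lg w)) := by
  refine ⟨⟨600, fun w S hw0 hS hw F hF x hx => LongDist.exists_run_longPredP hw0 hS hw hF hx⟩,
    fun bits c o hc ho hbits => ?_⟩
  obtain ⟨M, hM, hM'⟩ := LongDist.exists_bound_of_isLittleO ho
  exact ⟨_, fun w S hw0 hS hw => LongDist.indexBits_le hc hM hM' hbits hw0 hS hw⟩
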